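/- **Proposition 2 (Asymptotic normality).** *Model and quadrature.* Let $p,q\ge 0$ and $k\ge 1$ be fixed. In a generalized linear latent variable model the item densities are $$g_j(y_j\mid z;\theta)=\exp\Big\{\frac{y_j(\alpha_{0j}+\alpha_j^Tz)-b_j(\alpha_{0j}+\alpha_j^Tz)}{\phi_j}+c_j(y_j,\phi_j)\Big\},\qquad j=1,\dots,p,$$ with known functions $b_j$ (twice continuously differentiable) and $c_j$; put $g=\prod_j g_j$ and let $h$ be the standard normal density on $\mathbb R^q$. The vector $\theta\in\mathbb R^d$ consists of those among the parameters $\alpha_{0j},\alpha_{ji},\phi_j$ that are to be estimated; the others have known values. For $y\in\mathbb R^p$ let $\hat z=\arg\max_z[\log g(y\mid z;\theta)+\log h(z)]$, let $\Sigma$ be the inverse of the negative Hessian in $z$ of $\log g(y\mid z;\theta)+\log h(z)$ at $\hat z$, and let $\Sigma=TT^T$ be its Cholesky factorization. With the nodes $x_1,\dots,x_k$ and the weights $w_1,\dots,w_k$ of the $k$-point Gauss–Hermite rule for the weight $e^{-x^2}$, the adaptive Gauss–Hermite (AGH) approximation of the marginal density is $$\tilde f(y;\theta)=2^{q/2}|\det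 T|\sum_{t_1,\dots,t_q=1}^k g(y\mid z^*_t;\theta)\,h(z^*_t)\prod_{i=1}^q w_{t_i}e^{x_{t_i}^2},\qquad z^*_t=\sqrt2\,T(x_{t_1},\dots,x_{t_q})^T+\hat z .$$ Put $\Psi(y;\theta)=\partial\log\tilde f(y;\theta)/\partial\theta$ (the derivative takes the dependence of $\hat z$ and $T$ on $\theta$ into account). *Sample and regularity conditions.* Let $y_1,y_2,\dots$ be i.i.d. random vectors in $\mathbb R^p$ with an arbitrary common law (for instance that of the model for some true parameter value); $E$ denotes expectation under this law. Let $\Theta\subseteq\mathbb R^d$ be a parameter space on which all $\phi_j$ are positive, and $\theta_0\in\Theta$. Suppose: 1. for almost every $y$ and all $\theta\in\Theta$, the maximizer $\hat z$ exists and is unique, and the negative Hessian there is positive definite; 2. $\Theta$ is compact, or $\Theta$ is convex and $\log\tilde f(y;\cdot)$ is concave on $\Theta$ for almost every $y$; 3. $\log\tilde f(y;\theta)$ is measurable in $y$ and, for almost every $y$, continuous in $\theta\in\Theta$; and for each compact $K\subseteq\Theta$ there is an integrable $d$ with $|\log\tilde f(y;\theta)|\le d(y)$ for almost every $y$ and all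 $\theta\in K$; 4. $\theta\mapsto E[\log\tilde f(y;\theta)]$ has its unique maximum over $\Theta$ at $\theta_0$; 5. on a neighbourhood of $\theta_0$, $\log\tilde f(y;\cdot)$ is twice continuously differentiable for almost every $y$, with Hessian bounded in norm by an integrable function of $y$; 6. $E\|\Psi(y;\theta_0)\|^2<\infty$. *Estimators.* Let $\tilde\ell_n(\theta)=\sum_{l=1}^n\log\tilde f(y_l;\theta)$, and let $\hat\theta_n$ be AGH-based estimators, that is, random vectors such that, with probability tending to one, $\hat\theta_n\in\Theta$ and $\hat\theta_n$ solves $\sum_{l=1}^n\Psi(y_l;\theta)=0$ or maximizes $\tilde\ell_n$ over $\Theta$, and such that, for every $\varepsilon>0$, $P\big(\tilde\ell_n(\theta)\le\tilde\ell_n(\hat\theta_n)+n\varepsilon\text{ for all }\theta\in\Theta\big)\to1$ (which is automatic for maximizers of $\tilde\ell_n$). *Claim.* If $\theta_0$ is an interior point of $\Theta$ and $$B(\theta_0)=-E\Big[\frac{\partial\Psi(y;\theta_0)}{\partial\theta}\Big]=-E\Big[\frac{\partial^2\log\tilde f(y;\theta_0)}{\partial\theta\,\partial\theta^T}\Big]$$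 is nonsingular, then, as $n\to\infty$, $$\sqrt n\,(\hat\theta_n-\theta_0)\ \xrightarrow{D}\ N\big(0,\;B(\theta_0)^{-1}A(\theta_0)[B(\theta_0)^{-1}]^T\big),\qquad A(\theta_0)=E[\Psi(y;\theta_0)\Psi(y;\theta_0)^T].$$ -/

import Mathlib

open MeasureTheory ProbabilityTheory Filter Topology
open scoped Matrix Nat Gradient

/-- The index set of all parameters of a model with `p` items and `q` latent variables:
the intercepts `α₀ⱼ`, the loadings `αⱼᵢ` and the scale parameters `φⱼ`. -/
abbrev ParamIndex (p q : ℕ) : Type := Fin p ⊕ (Fin p × Fin q) ⊕ Fin p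

/-- A generalized linear latent variable model: the known functions `bⱼ` and `cⱼ` of the
exponential families of the items, the set of those parameters that are to be estimated, and the
known values of the others (for instance `φⱼ = 1` for binary items, or loadings set to `0`). -/
structure GLLVM (p q : ℕ) where
  /-- the functions `bⱼ` -/
  b : Fin p → ℝ → ℝ
  /-- the functions `cⱼ` -/
  c : Fin p → ℝ → ℝ → ℝ
  /-- the parameters that are to be estimated -/
  free : Finset (ParamIndex p q)
  /-- the values of the remaining parameters (the other values are not used) -/
  fixed : ParamIndex p q → ℝ

/-! ### The Gauss-Hermite rule -/

/-- The nodes of the Gauss-Hermite rule with `k` points for the weight `exp (-x ^ 2)`: the zeros of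
the physicists' Hermite polynomial `H_k (x) = 2 ^ (k / 2) * He_k (√2 x)`, where `He_k` is
`Polynomial.hermite k`. -/
noncomputable def ghNodes (k : ℕ) : Finset ℝ :=
  ((Polynomial.hermite k).map (Int.castRingHom ℝ)).roots.toFinset.image (fun x => x / √2)

/-- The weight of the Gauss-Hermite rule with `k` points at the node `x`,
`2 ^ (k - 1) * k! * √π / (k ^ 2 * H_{k-1} (x) ^ 2) = k! * √π / (k ^ 2 * He_{k-1} (√2 x) ^ 2)`. -/
noncomputable def ghWeight (k : ℕ) (x : ℝ) : ℝ :=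
  (k ! : ℝ) * √Real.pi / ((k : ℝ) ^ 2 * (Polynomial.aeval (√2 * x) (Polynomial.hermite (k - 1))) ^ 2)

/-- The adaptive weight `w* = w * exp (x ^ 2)`. -/
noncomputable def aghWeight (k : ℕ) (x : ℝ) : ℝ := ghWeight k x * Real.exp (x ^ 2)

/-! ### Cholesky factors -/

/-- `T` is the Cholesky factor of `S`: lower triangular with positive diagonal, `S = T Tᵀ`. -/
def IsCholeskyFactor {q : ℕ} (S T : Matrix (Fin q) (Fin q) ℝ) : Prop :=
  (∀ i j, i < j → T i j = 0) ∧ (∀ i, 0 < T i i) ∧ T * Tᵀ = S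

open Classical in
/-- The Cholesky factor of `S` (equal to `0` if there is none). -/
noncomputable def choleskyFactor {q : ℕ} (S : Matrix (Fin q) (Fin q) ℝ) :
    Matrix (Fin q) (Fin q) ℝ :=
  if h : ∃ T, IsCholeskyFactor S T then h.choose else 0

/-! ### Matrix of second partial derivatives -/

/-- The matrix of second partial derivatives of a function on `ℝ^q`. -/
noncomputable def hessianMatrix {q : ℕ} (f : (Fin q → ℝ) → ℝ) (z : Fin q → ℝ) :
    Matrix (Fin q) (Fin q) ℝ :=
  Matrix.of fun i j => fderiv ℝ (fun w => fderiv ℝ f w (Pi.single j 1)) z (Pi.single i 1)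

namespace GLLVM

variable {p q : ℕ} (M : GLLVM p q)

/-- The space of the vectors `θ` of parameters that are to be estimated. -/
abbrev Param : Type := EuclideanSpace ℝ M.free

/-- The vector of all parameters. -/
noncomputable def full (θ : M.Param) (i : ParamIndex p q) : ℝ :=
  if h : i ∈ M.free then θ ⟨i, h⟩ else M.fixed i

/-- The intercept `α₀ⱼ`. -/
noncomputable def intercept (θ : M.Param) (j : Fin p) : ℝ := M.full θ (Sum.inl j)

/-- The vector `αⱼ` of the loadings of item `j`. -/
noncomputable def loading (θ : M.Param) (j : Fin p) : Fin q → ℝ :=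
  fun i => M.full θ (Sum.inr (Sum.inl (j, i)))

/-- The scale parameter `φⱼ`. -/
noncomputable def scale (θ : M.Param) (j : Fin p) : ℝ := M.full θ (Sum.inr (Sum.inr j))

/-- The linear predictor `α₀ⱼ + αⱼᵀ z`. -/
noncomputable def predictor (θ : M.Param) (j : Fin p) (z : Fin q → ℝ) : ℝ :=
  M.intercept θ j + M.loading θ j ⬝ᵥ z

/-- The conditional density `g(y | z; θ)`, the product of the densities of the items. -/
noncomputable def condDensity (y : Fin p → ℝ) (z : Fin q → ℝ) (θ : M.Param) : ℝ :=
  ∏ j, Real.exp ((y j * M.predictor θ j z - M.b j (M.predictor θ j z)) / M.scale θ j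
    + M.c j (y j) (M.scale θ j))

/-- The standard normal density `h` of the latent variables. -/
noncomputable def latentDensity (z : Fin q → ℝ) : ℝ :=
  (2 * Real.pi) ^ (-(q : ℝ) / 2) * Real.exp (-(1 / 2) * (z ⬝ᵥ z))

/-- The function `log g(y | z; θ) + log h(z)`. -/
noncomputable def logJoint (y : Fin p → ℝ) (θ : M.Param) (z : Fin q → ℝ) : ℝ :=
  Real.log (M.condDensity y z θ) + Real.log (latentDensity z)

/-- `z` is the unique maximizer of `log g(y | ·; θ) + log h`, and the negative second derivative
there is positive definite. -/
def IsRegularMode (y : Fin p → ℝ) (θ : M.Param) (z : Fin q → ℝ) : Prop :=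
  (∀ w, w ≠ z → M.logJoint y θ w < M.logJoint y θ z) ∧
    (-hessianMatrix (M.logJoint y θ) z).PosDef

open Classical in
/-- The mode `ẑ` of `log g(y | ·; θ) + log h` (equal to `0` if there is none). -/
noncomputable def mode (y : Fin p → ℝ) (θ : M.Param) : Fin q → ℝ :=
  if h : ∃ z, IsMaxOn (M.logJoint y θ) Set.univ z then h.choose else 0

/-- The inverse of the negative second derivative of `log g(y | ·; θ) + log h` at the mode. -/
noncomputable def modeCov (y : Fin p → ℝ) (θ : M.Param) : Matrix (Fin q) (Fin q) ℝ :=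
  (-hessianMatrix (M.logJoint y θ) (M.mode y θ))⁻¹

/-- The Cholesky factor `T` of the matrix `modeCov`. -/
noncomputable def modeFactor (y : Fin p → ℝ) (θ : M.Param) : Matrix (Fin q) (Fin q) ℝ :=
  choleskyFactor (M.modeCov y θ)

/-- The adaptive node `z* = √2 T t + ẑ` that belongs to the node `t` of the product rule. -/
noncomputable def aghNode (y : Fin p → ℝ) (θ : M.Param) (t : Fin q → ℝ) : Fin q → ℝ :=
  √2 • (M.modeFactor y θ *ᵥ t) + M.mode y θ

/-- The adaptive Gauss-Hermite approximation with `k` points per dimension of the marginal density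
`∫ g(y | z; θ) h(z) dz`. -/
noncomputable def aghDensity (k : ℕ) (y : Fin p → ℝ) (θ : M.Param) : ℝ :=
  2 ^ ((q : ℝ) / 2) * |(M.modeFactor y θ).det| *
    ∑ t ∈ Fintype.piFinset (fun _ : Fin q => ghNodes k),
      M.condDensity y (M.aghNode y θ t) θ * latentDensity (M.aghNode y θ t) *
        ∏ i, aghWeight k (t i)

/-- The approximated log-likelihood of one observation. -/
noncomputable def logAGH (k : ℕ) (y : Fin p → ℝ) (θ : M.Param) : ℝ :=
  Real.log (M.aghDensity k y θ)

/-- The approximated log-likelihood of the sample `y 0, …, y (n - 1)`. -/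
noncomputable def logLik (k n : ℕ) (y : ℕ → Fin p → ℝ) (θ : M.Param) : ℝ :=
  ∑ l ∈ Finset.range n, M.logAGH k (y l) θ

/-- The function `Ψ(y; θ)`, the approximated score of one observation. -/
noncomputable def psi (k : ℕ) (y : Fin p → ℝ) (θ : M.Param) : M.Param :=
  ∇ (M.logAGH k y) θ

/-- The approximated score of the sample `y 0, …, y (n - 1)`. -/
noncomputable def score (k n : ℕ) (y : ℕ → Fin p → ℝ) (θ : M.Param) : M.Param :=
  ∑ l ∈ Finset.range n, M.psi k (y l) θ

/-- The matrix `A(θ) = E[Ψ Ψᵀ]`, when the observations have the law `P`. -/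
noncomputable def matA (k : ℕ) (P : Measure (Fin p → ℝ)) (θ : M.Param) :
    Matrix M.free M.free ℝ :=
  Matrix.of fun i j => ∫ y, M.psi k y θ i * M.psi k y θ j ∂P

/-- The matrix `B(θ) = -E[∂Ψ/∂θ]`, when the observations have the law `P`. -/
noncomputable def matB (k : ℕ) (P : Measure (Fin p → ℝ)) (θ : M.Param) :
    Matrix M.free M.free ℝ :=
  Matrix.of fun i j => -∫ y, (fderiv ℝ (M.psi k y) θ (EuclideanSpace.single j 1)) i ∂P

/-- `θhat n` is an adaptive maximum likelihood estimator from the observations `Y 0, …, Y (n - 1)`: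
with probability tending to one it is a point of `Θ` that solves the approximated score equation or
maximizes the approximated log-likelihood over `Θ`, and its normalized approximated log-likelihood
is at least the supremum over `Θ` up to an error that tends to zero in probability. (A maximizer
over `Θ` has the last property trivially; for a root of the score equation it singles out the
relevant root.) -/
structure IsAGHEstimator (k : ℕ) (Θ : Set M.Param) {Ω : Type*} [MeasurableSpace Ω] (μ : Measure Ω)
    (Y : ℕ → Ω → Fin p → ℝ) (θhat : ℕ → Ω → M.Param) : Prop where
  aemeasurable : ∀ n, AEMeasurable (θhat n) μ
  solves : Tendsto (fun n => μ {ω | ¬ (θhat n ω ∈ Θ ∧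
      (M.score k n (fun l => Y l ω) (θhat n ω) = 0 ∨
        IsMaxOn (M.logLik k n (fun l => Y l ω)) Θ (θhat n ω)))}) atTop (𝓝 0)
  nearlyMaximal : ∀ ε : ℝ, 0 < ε → Tendsto (fun n => μ {ω | ∃ θ ∈ Θ,
      M.logLik k n (fun l => Y l ω) (θhat n ω) + n * ε < M.logLik k n (fun l => Y l ω) θ})
    atTop (𝓝 0)

end GLLVM

/-! The estimator is treated as an M-estimator with criterion m(y, θ) = `M.logAGH k y θ`. The filter
`inProb μ` turns "with probability tending to one" into `∀ᶠ`, so that finitely many such statements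
combine by `filter_upwards`.

Consistency is Wald's argument (`eventually_dist_lt_of_isCompact`). Continuity and domination give a
one-sided uniform law of large numbers on a compact set K ⊆ Θ that avoids θ₀: on K the normalized
criterion stays below E m(θ₀) - ε, while at θ₀, hence at the nearly maximal estimator, it falls
short of E m(θ₀) by less than ε. If Θ is compact, K is Θ without a ball around θ₀. In the concave
case K is a small sphere, since on a segment from θ₀ a concave criterion is at least the smaller of
its end values.

For normality, consistency puts the estimator inside Θ, where a maximizer is also a root of the
score. With Δ = θhat - θ₀, S the score sum at θ₀ and H = E[∂Ψ/∂θ] = -B, the expansion reads 0 = S +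
n H Δ + o(n‖Δ‖), the remainder being controlled by an integrable modulus of continuity of the
Hessian (`eventually_norm_score_expansion_le`). Multiplying by G = B⁻¹ gives √n Δ = n^(-1/2) G S +
o(√n ‖Δ‖). The main term converges by the multivariate central limit theorem, the score having mean
zero because θ₀ maximizes E m. The main term is therefore tight, which makes the relative error
absolutely small (`tendsto_sub_inProb_of_norm_sub_le`), and Slutsky's theorem concludes. -/

/-! ### Events whose probability tends to one -/

/-- The filter of the sequences of events `A n` (as subsets of `ℕ × Ω`) whose outer probability
tends to one. -/
def inProb {Ω : Type*} [MeasurableSpace Ω] (μ : Measure Ω) : Filter (ℕ × Ω) where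
  sets := {s | Tendsto (fun n => μ {ω | (n, ω) ∉ s}) atTop (𝓝 0)}
  univ_sets := by simp
  sets_of_superset {s t} hs hst := by
    refine tendsto_of_tendsto_of_tendsto_of_le_of_le tendsto_const_nhds hs (fun _ => zero_le) ?_
    exact fun n => measure_mono fun ω hω h => hω (hst h)
  inter_sets {s t} hs ht := by
    refine tendsto_of_tendsto_of_tendsto_of_le_of_le tendsto_const_nhds
      (by simpa using Tendsto.add hs ht) (fun _ => zero_le) fun n => ?_
    refine (measure_mono fun ω hω => ?_).trans (measure_union_le _ _)
    by_contra h
    simp only [Set.mem_union, Set.mem_ofPred_eq, not_or, not_not] at h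
    exact hω h

section InProb

variable {Ω : Type*} [MeasurableSpace Ω] {μ : Measure Ω}

theorem eventually_inProb {r : ℕ × Ω → Prop} :
    (∀ᶠ x in inProb μ, r x) ↔ Tendsto (fun n => μ {ω | ¬ r (n, ω)}) atTop (𝓝 0) := Iff.rfl

theorem eventually_inProb_of_ae {r : Ω → Prop} (h : ∀ᵐ ω ∂μ, r ω) :
    ∀ᶠ x in inProb μ, r x.2 := by
  rw [eventually_inProb]
  have : μ {ω | ¬ r ω} = 0 := h
  simp [this]

theorem tendsto_fst_inProb : Tendsto Prod.fst (inProb μ) atTop := by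
  intro s hs
  change ∀ᶠ x in inProb μ, x.1 ∈ s
  rw [eventually_inProb]
  refine tendsto_const_nhds.congr' ?_
  filter_upwards [hs] with n hn
  have hn' : n ∈ s := hn
  simp [hn']

/-- The bridge between the filter language and convergence in probability. -/
theorem tendsto_inProb_iff {V : Type*} [SeminormedAddCommGroup V] {f : ℕ → Ω → V} {c : V} :
    Tendsto (fun x : ℕ × Ω => f x.1 x.2) (inProb μ) (𝓝 c) ↔
      TendstoInMeasure μ f atTop (fun _ => c) := by
  rw [tendstoInMeasure_iff_norm, Metric.tendsto_nhds]
  refine forall₂_congr fun ε _ => ?_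
  rw [eventually_inProb]
  simp [dist_eq_norm]

variable {X : Type*} [MeasurableSpace X] {P : Measure X}
  {Y : ℕ → Ω → X}

theorem ae_sample (hY : ∀ l, Measurable (Y l)) (hlaw : ∀ l, μ.map (Y l) = P) {r : X → Prop}
    (h : ∀ᵐ y ∂P, r y) : ∀ᵐ ω ∂μ, ∀ l, r (Y l ω) := by
  rw [ae_all_iff]
  intro l
  rw [← hlaw l] at h
  exact ae_of_ae_map (hY l).aemeasurable h

variable [IsProbabilityMeasure μ]

/-- The weak law of large numbers for averages of an integrable function of the observations. -/
theorem tendsto_average_inProb (hY : ∀ l, Measurable (Y l)) (hlaw : ∀ l, μ.map (Y l) = P)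
    (hindep : iIndepFun Y μ) {V : Type*} [NormedAddCommGroup V] [NormedSpace ℝ V]
    [CompleteSpace V] [MeasurableSpace V] [BorelSpace V] {F : X → V} (hF : Integrable F P) :
    Tendsto (fun x : ℕ × Ω => (x.1 : ℝ)⁻¹ • ∑ l ∈ Finset.range x.1, F (Y l x.2)) (inProb μ)
      (𝓝 (∫ y, F y ∂P)) := by
  have hFY : ∀ l, Integrable (fun ω => F (Y l ω)) μ := fun l =>
    Integrable.comp_aemeasurable (f := Y l) (by rwa [hlaw l]) (hY l).aemeasurable
  have hFm : ∀ l, AEMeasurable F (μ.map (Y l)) := fun l => by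
    rw [hlaw l]; exact hF.aestronglyMeasurable.aemeasurable
  have hmean : ∫ ω, F (Y 0 ω) ∂μ = ∫ y, F y ∂P := by
    rw [← hlaw 0, integral_map (hY 0).aemeasurable]
    rw [hlaw 0]; exact hF.aestronglyMeasurable
  -- Pairwise independence is enough for the strong law; almost sure convergence then gives
  -- convergence in probability.
  have hlim := strong_law_ae (fun l ω => F (Y l ω)) (hFY 0)
    (fun i j hij => ((hindep.comp₀ (fun _ => F) (fun l => (hY l).aemeasurable) hFm).indepFun hij))
    (fun l => IdentDistrib.comp_of_aemeasurable
      ⟨(hY l).aemeasurable, (hY 0).aemeasurable, by rw [hlaw l, hlaw 0]⟩ (hFm l))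
  rw [hmean] at hlim
  refine (tendsto_inProb_iff
    (f := fun n ω => (n : ℝ)⁻¹ • ∑ l ∈ Finset.range n, F (Y l ω))).2 ?_
  refine tendstoInMeasure_of_tendsto_ae (fun n => ?_) hlim
  exact (Finset.aestronglyMeasurable_fun_sum _ fun l _ => (hFY l).aestronglyMeasurable).const_smul _

/-- If the integral of `F` is less than `c`, then its sample sums are at most `n * c`. -/
theorem eventually_sum_le (hY : ∀ l, Measurable (Y l)) (hlaw : ∀ l, μ.map (Y l) = P)
    (hindep : iIndepFun Y μ) {F : X → ℝ} (hF : Integrable F P) {c : ℝ} (hc : ∫ y, F y ∂P < c) :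
    ∀ᶠ x : ℕ × Ω in inProb μ, ∑ l ∈ Finset.range x.1, F (Y l x.2) ≤ x.1 * c := by
  filter_upwards [(tendsto_average_inProb hY hlaw hindep hF).eventually_lt_const hc,
    tendsto_fst_inProb.eventually_gt_atTop 0] with x hx hn
  have hn' : (0 : ℝ) < x.1 := by exact_mod_cast hn
  rw [smul_eq_mul, inv_mul_lt_iff₀ hn'] at hx
  exact hx.le

end InProb

/-! ### Local moduli of continuity and uniform bounds -/

/-- A dominated family of functions that is continuous in the parameter has, near every parameter,
a modulus of continuity with small integral. -/
theorem exists_integrable_modulus {X : Type*} [MeasurableSpace X] {P : Measure X}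
    {E V : Type*} [PseudoMetricSpace E] [SecondCountableTopology E] [NormedAddCommGroup V]
    {f : X → E → V} {s : Set E} {θ₁ : E} (hθ₁ : θ₁ ∈ s)
    (hmeas : ∀ θ ∈ s, AEStronglyMeasurable (fun y => f y θ) P)
    (hcont : ∀ᵐ y ∂P, ContinuousOn (f y) s) {d : X → ℝ} (hd : Integrable d P)
    (hbound : ∀ᵐ y ∂P, ∀ θ ∈ s, ‖f y θ‖ ≤ d y) {ε : ℝ} (hε : 0 < ε) :
    ∃ δ > 0, ∃ w : X → ℝ, Integrable w P ∧ ∫ y, w y ∂P < ε ∧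
      ∀ᵐ y ∂P, ∀ θ ∈ s ∩ Metric.ball θ₁ δ, ‖f y θ - f y θ₁‖ ≤ w y := by
  obtain ⟨t, hts, htc, hst⟩ :=
    (TopologicalSpace.IsSeparable.of_separableSpace s).exists_countable_dense_subset
  let δ : ℕ → ℝ := fun n => 1 / ((n : ℝ) + 1)
  have hδ : ∀ n, 0 < δ n := fun n => by positivity
  -- A supremum over a countable dense set is measurable in y, and in `ENNReal` it exists before any
  -- bound is known.
  let W : ℕ → X → ENNReal := fun n y =>
    ⨆ θ ∈ t ∩ Metric.ball θ₁ (δ n), ‖f y θ - f y θ₁‖ₑ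
  have hWm : ∀ n, AEMeasurable (W n) P := fun n =>
    AEMeasurable.biSup _ (htc.mono Set.inter_subset_left) fun θ hθ =>
      ((hmeas θ (hts hθ.1)).sub (hmeas θ₁ hθ₁)).enorm
  have hWle : ∀ n, ∀ᵐ y ∂P, W n y ≤ ENNReal.ofReal (2 * d y) := by
    intro n
    filter_upwards [hbound] with y hy
    refine iSup₂_le fun θ hθ => ?_
    rw [← ofReal_norm]
    refine ENNReal.ofReal_le_ofReal ((norm_sub_le _ _).trans ?_)
    linarith [hy θ (hts hθ.1), hy θ₁ hθ₁]
  have hWlim : ∀ᵐ y ∂P, Tendsto (fun n => (W n y).toReal) atTop (𝓝 0) := by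
    filter_upwards [hcont] with y hy
    rw [← ENNReal.toReal_zero]
    refine (ENNReal.tendsto_toReal ENNReal.zero_ne_top).comp ?_
    rw [ENNReal.tendsto_atTop_zero]
    intro η hη
    have h1 : Tendsto (fun θ => ‖f y θ - f y θ₁‖ₑ) (𝓝[s] θ₁) (𝓝 0) := by
      have : Tendsto (fun θ => f y θ - f y θ₁) (𝓝[s] θ₁) (𝓝 0) := by
        simpa using (hy θ₁ hθ₁).sub_const (f y θ₁)
      simpa using this.enorm
    obtain ⟨r, hr, hr'⟩ := Metric.mem_nhdsWithin_iff.1 (h1.eventually_le_const hη)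
    obtain ⟨N, hN⟩ := exists_nat_one_div_lt hr
    refine ⟨N, fun n hn => iSup₂_le fun θ hθ => hr' ⟨?_, hts hθ.1⟩⟩
    refine Metric.ball_subset_ball ?_ hθ.2
    exact (one_div_le_one_div_of_le (by positivity) (by gcongr)).trans hN.le
  have hd2 : Integrable (fun y => 2 * d y) P := hd.const_mul 2
  have hnorm : ∀ n, ∀ᵐ y ∂P, ‖(W n y).toReal‖ ≤ 2 * d y := by
    intro n
    filter_upwards [hWle n, hbound] with y hy hb
    have h0 : 0 ≤ d y := (norm_nonneg _).trans (hb θ₁ hθ₁)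
    rw [Real.norm_of_nonneg ENNReal.toReal_nonneg]
    exact ENNReal.toReal_le_of_le_ofReal (by positivity) hy
  have hlim := tendsto_integral_of_dominated_convergence (fun y => 2 * d y)
    (fun n => (hWm n).ennreal_toReal.aestronglyMeasurable) hd2 hnorm hWlim
  rw [integral_zero] at hlim
  obtain ⟨n, hn⟩ := (hlim.eventually_lt_const hε).exists
  refine ⟨δ n, hδ n, fun y => (W n y).toReal,
    hd2.mono' (hWm n).ennreal_toReal.aestronglyMeasurable (hnorm n), hn, ?_⟩
  filter_upwards [hcont, hWle n] with y hy hW θ hθ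
  have hfin : W n y ≠ ⊤ := (hW.trans_lt ENNReal.ofReal_lt_top).ne
  -- The ball is open, so points of `t` in the ball accumulate at θ; continuity carries the bound
  -- from them to θ.
  have hcl : θ ∈ closure (t ∩ Metric.ball θ₁ (δ n)) := by
    rw [Set.inter_comm]
    exact Metric.isOpen_ball.inter_closure ⟨hθ.2, hst hθ.1⟩
  have hnb : (𝓝[t ∩ Metric.ball θ₁ (δ n)] θ).NeBot := mem_closure_iff_nhdsWithin_neBot.1 hcl
  have hc : Tendsto (fun θ' => ‖f y θ' - f y θ₁‖) (𝓝[t ∩ Metric.ball θ₁ (δ n)] θ)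
      (𝓝 ‖f y θ - f y θ₁‖) :=
    (((hy θ hθ.1).mono (Set.inter_subset_left.trans hts)).sub_const (f y θ₁)).norm
  refine le_of_tendsto hc ?_
  filter_upwards [self_mem_nhdsWithin] with θ' hθ'
  rw [← toReal_enorm]
  exact ENNReal.toReal_mono hfin (le_iSup₂ (f := fun θ _ => ‖f y θ - f y θ₁‖ₑ) θ' hθ')

/-- The one-sided uniform law of large numbers on compact sets. -/
theorem exists_eventually_sum_le_of_isCompact {Ω : Type*} [MeasurableSpace Ω] {μ : Measure Ω}
    [IsProbabilityMeasure μ] {X : Type*} [MeasurableSpace X] {P : Measure X} {Y : ℕ → Ω → X}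
    (hY : ∀ l, Measurable (Y l)) (hlaw : ∀ l, μ.map (Y l) = P) (hindep : iIndepFun Y μ)
    {E : Type*} [PseudoMetricSpace E] [SecondCountableTopology E] {m : X → E → ℝ} {K : Set E}
    (hK : IsCompact K) (hmeas : ∀ θ ∈ K, AEMeasurable (fun y => m y θ) P)
    (hcont : ∀ᵐ y ∂P, ContinuousOn (m y) K) {d : X → ℝ} (hd : Integrable d P)
    (hbound : ∀ᵐ y ∂P, ∀ θ ∈ K, |m y θ| ≤ d y) {c : ℝ} (hc : ∀ θ ∈ K, ∫ y, m y θ ∂P < c) :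
    ∃ ε > 0, ∀ᶠ x : ℕ × Ω in inProb μ, ∀ θ ∈ K,
      ∑ l ∈ Finset.range x.1, m (Y l x.2) θ ≤ x.1 * (c - ε) := by
  have key : ∃ ε > 0, ∀ᶠ x : ℕ × Ω in inProb μ, ∀ θ ∈ K, θ ∈ K →
      ∑ l ∈ Finset.range x.1, m (Y l x.2) θ ≤ x.1 * (c - ε) := by
    -- The induction runs over arbitrary sets S, so membership in K has to be carried inside the
    -- predicate.
    refine hK.induction_on (p := fun S => ∃ ε > 0, ∀ᶠ x : ℕ × Ω in inProb μ, ∀ θ ∈ S, θ ∈ K →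
      ∑ l ∈ Finset.range x.1, m (Y l x.2) θ ≤ x.1 * (c - ε)) ⟨1, one_pos, by simp⟩ ?_ ?_ ?_
    · rintro s t hst ⟨ε, hε, h⟩
      exact ⟨ε, hε, h.mono fun x hx θ hθ => hx θ (hst hθ)⟩
    · rintro s t ⟨ε, hε, h⟩ ⟨ε', hε', h'⟩
      refine ⟨min ε ε', lt_min hε hε', ?_⟩
      filter_upwards [h, h'] with x hx hx' θ hθ hθK
      rcases hθ with hθ | hθ
      · refine (hx θ hθ hθK).trans ?_
        gcongr
        exact min_le_left _ _
      · refine (hx' θ hθ hθK).trans ?_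
        gcongr
        exact min_le_right _ _
    · intro θ₁ hθ₁
      -- One third of the gap covers the integral of the modulus, one third is the asserted margin,
      -- and one third keeps the inequality strict.
      set e := (c - ∫ y, m y θ₁ ∂P) / 3 with he
      have he0 : 0 < e := by have := hc θ₁ hθ₁; rw [he]; linarith
      obtain ⟨δ, hδ, w, hw, hwe, hwb⟩ := exists_integrable_modulus (f := m) hθ₁
        (fun θ hθ => (hmeas θ hθ).aestronglyMeasurable) hcont hd
        (by simpa only [Real.norm_eq_abs] using hbound) he0
      have hm : Integrable (fun y => m y θ₁) P :=
        hd.mono' (hmeas θ₁ hθ₁).aestronglyMeasurable (hbound.mono fun y hy => hy θ₁ hθ₁)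
      have hsum : ∫ y, (m y θ₁ + w y) ∂P < c - e := by
        rw [integral_add hm hw]; linarith
      refine ⟨K ∩ Metric.ball θ₁ δ, inter_mem_nhdsWithin _ (Metric.ball_mem_nhds _ hδ), e, he0, ?_⟩
      filter_upwards [eventually_sum_le hY hlaw hindep (hm.add hw) hsum,
        eventually_inProb_of_ae (ae_sample hY hlaw hwb)] with x hx hx' θ hθ _
      refine (Finset.sum_le_sum fun l _ => ?_).trans hx
      have := (abs_le.1 (hx' l θ hθ)).2
      simp only [Pi.add_apply]
      linarith
  obtain ⟨ε, hε, h⟩ := key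
  exact ⟨ε, hε, h.mono fun x hx θ hθ => hx θ hθ hθ⟩

/-! ### Measurability of derivatives in a parameter -/

/-- Along a fixed direction the derivative is an almost everywhere limit of measurable difference
quotients; finitely many directions determine the operator. -/
theorem aestronglyMeasurable_fderiv_param {X : Type*} [MeasurableSpace X] {P : Measure X}
    {E V : Type*} [NormedAddCommGroup E] [InnerProductSpace ℝ E] [FiniteDimensional ℝ E]
    [NormedAddCommGroup V] [NormedSpace ℝ V] {f : X → E → V} {U : Set E} {θ : E}
    (hU : U ∈ 𝓝 θ) (hmeas : ∀ θ' ∈ U, AEStronglyMeasurable (fun y => f y θ') P)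
    (hdiff : ∀ᵐ y ∂P, DifferentiableAt ℝ (f y) θ) :
    AEStronglyMeasurable (fun y => fderiv ℝ (f y) θ) P := by
  have happly : ∀ v : E, AEStronglyMeasurable (fun y => fderiv ℝ (f y) θ v) P := by
    intro v
    have hc : Tendsto (fun n : ℕ => ‖(n : ℝ)‖) atTop atTop := by
      simpa using tendsto_natCast_atTop_atTop (R := ℝ)
    have hθ : Tendsto (fun n : ℕ => θ + (n : ℝ)⁻¹ • v) atTop (𝓝 θ) := by
      simpa using (tendsto_inv_atTop_nhds_zero_nat (𝕜 := ℝ)).smul_const v |>.const_add θ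
    -- Shifting the sequence by N keeps every evaluation point in `U`, where measurability is known.
    obtain ⟨N, hN⟩ := eventually_atTop.1 (hθ.eventually_mem hU)
    refine aestronglyMeasurable_of_tendsto_ae atTop
      (f := fun (n : ℕ) y => ((n + N : ℕ) : ℝ) • (f y (θ + ((n + N : ℕ) : ℝ)⁻¹ • v) - f y θ))
      (fun n => ((hmeas _ (hN _ (Nat.le_add_left N n))).sub
        (hmeas _ (mem_of_mem_nhds hU))).const_smul _) ?_
    filter_upwards [hdiff] with y hy
    exact (hy.hasFDerivAt.lim v hc).comp (tendsto_add_atTop_nat N)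
  let b := stdOrthonormalBasis ℝ E
  have hsum : ∀ A : E →L[ℝ] V, A = ∑ i, (innerSL ℝ (b i)).smulRight (A (b i)) := by
    intro A
    ext v
    conv_lhs => rw [← b.sum_repr' v]
    simp
  have heq : (fun y => fderiv ℝ (f y) θ) =
      fun y => ∑ i, (innerSL ℝ (b i)).smulRight (fderiv ℝ (f y) θ (b i)) :=
    funext fun y => hsum _
  rw [heq]
  refine Finset.aestronglyMeasurable_fun_sum _ fun i _ => ?_
  exact (ContinuousLinearMap.smulRightL ℝ E V (innerSL ℝ (b i))).continuous.comp_aestronglyMeasurable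
    (happly (b i))

/-! ### The multivariate central limit theorem -/

section CLT

variable {ι : Type*} [Fintype ι] {X : Type*} [MeasurableSpace X] {P : Measure X}
  {F : X → EuclideanSpace ℝ ι}

/-- The matrix of second moments of a random vector. -/
noncomputable def secondMoment (P : Measure X) (F : X → EuclideanSpace ℝ ι) : Matrix ι ι ℝ :=
  Matrix.of fun i j => ∫ y, F y i * F y j ∂P

theorem integrable_mul_apply (hF : MemLp F 2 P) (i j : ι) :
    Integrable (fun y => F y i * F y j) P := by
  have h : ∀ i, MemLp (fun y => F y i) 2 P := fun i =>
    (EuclideanSpace.proj (𝕜 := ℝ) i).comp_memLp' hF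
  exact (h i).integrable_mul (h j)

/-- For centered `F` this is the variance of the projection on `t`, which the one-dimensional limit
theorem produces. -/
theorem secondMoment_quadratic (hF : MemLp F 2 P) (t : EuclideanSpace ℝ ι) :
    t ⬝ᵥ secondMoment P F *ᵥ t = ∫ y, inner ℝ (F y) t ^ 2 ∂P := by
  have h : ∀ y, inner ℝ (F y) t ^ 2 = ∑ i, ∑ j, t i * t j * (F y i * F y j) := by
    intro y
    simp only [PiLp.inner_apply, RCLike.inner_apply, conj_trivial, sq, Finset.sum_mul_sum]
    exact Finset.sum_congr rfl fun i _ => Finset.sum_congr rfl fun j _ => by ring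
  simp_rw [h]
  rw [integral_finsetSum _ fun i _ => integrable_finsetSum _ fun j _ =>
    (integrable_mul_apply hF i j).const_mul _]
  simp_rw [dotProduct, Matrix.mulVec, dotProduct, Finset.mul_sum]
  refine Finset.sum_congr rfl fun i _ => ?_
  rw [integral_finsetSum _ fun j _ => (integrable_mul_apply hF i j).const_mul _]
  refine Finset.sum_congr rfl fun j _ => ?_
  rw [integral_const_mul, secondMoment, Matrix.of_apply]
  ring

theorem posSemidef_secondMoment (hF : MemLp F 2 P) : (secondMoment P F).PosSemidef := by
  refine Matrix.PosSemidef.of_dotProduct_mulVec_nonneg ?_ fun t => ?_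
  · ext i j
    simp [secondMoment, mul_comm]
  · have := secondMoment_quadratic hF (WithLp.toLp 2 t)
    simp only [star_trivial]
    change t ⬝ᵥ secondMoment P F *ᵥ t = _ at this
    rw [this]
    exact integral_nonneg fun y => sq_nonneg _

/-- The Cramér–Wold device: it reduces the vector limit theorem to real projections. -/
theorem charFun_map_eq_charFun_map_inner {Ω : Type*} [MeasurableSpace Ω] {μ : Measure Ω}
    {Z : Ω → EuclideanSpace ℝ ι} (hZ : AEMeasurable Z μ) (t : EuclideanSpace ℝ ι) :
    charFun (μ.map Z) t = charFun (μ.map fun ω => inner ℝ (Z ω) t) 1 := by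
  rw [charFun_apply, charFun_apply, integral_map hZ (by fun_prop),
    integral_map hZ.inner_const (by fun_prop)]
  simp

theorem tendsto_charFun_one_inv_sqrt_mul_sum {Ω : Type*} [MeasurableSpace Ω] {μ : Measure Ω}
    [IsProbabilityMeasure μ] {Z : ℕ → Ω → ℝ} (hZ : MemLp (Z 0) 2 μ) (hZ0 : ∫ ω, Z 0 ω ∂μ = 0)
    (hind : iIndepFun Z μ) (hid : ∀ l, IdentDistrib (Z l) (Z 0) μ μ) :
    Tendsto (fun n : ℕ => charFun (μ.map fun ω => (√(n : ℝ))⁻¹ * ∑ l ∈ Finset.range n, Z l ω) 1)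
      atTop (𝓝 (Complex.exp (-(Var[Z 0; μ] : ℂ) / 2))) := by
  have hclt := tendstoInDistribution_inv_sqrt_mul_sum_sub
    (P' := gaussianReal 0 Var[Z 0; μ].toNNReal) (Y := id)
    ⟨aemeasurable_id, Measure.map_id⟩ hZ hind hid
  have hlim := ProbabilityMeasure.tendsto_iff_tendsto_charFun.1 hclt.tendsto 1
  simp only [ProbabilityMeasure.coe_mk, Measure.map_id, charFun_gaussianReal, hZ0, mul_zero,
    sub_zero] at hlim
  convert! hlim using 2
  rw [Real.coe_toNNReal _ (variance_nonneg _ _)]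
  simp [neg_div]

/-- The central limit theorem for the projections of centered random vectors, in terms of
characteristic functions. -/
theorem tendsto_charFun_inner_inv_sqrt_smul_sum {Ω : Type*} [MeasurableSpace Ω] {μ : Measure Ω}
    [IsProbabilityMeasure μ] {Y : ℕ → Ω → X}
    (hY : ∀ l, Measurable (Y l)) (hlaw : ∀ l, μ.map (Y l) = P) (hindep : iIndepFun Y μ)
    [IsProbabilityMeasure P] (hF : MemLp F 2 P) (hF0 : ∫ y, F y ∂P = 0)
    (t : EuclideanSpace ℝ ι) :
    Tendsto (fun n : ℕ => charFun (μ.map fun ω => inner ℝ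
      ((√(n : ℝ))⁻¹ • ∑ l ∈ Finset.range n, F (Y l ω)) t) 1) atTop
      (𝓝 (Complex.exp (-((t ⬝ᵥ secondMoment P F *ᵥ t : ℝ) : ℂ) / 2))) := by
  have hFm : ∀ l, AEMeasurable (fun y => inner ℝ (F y) t) (μ.map (Y l)) := fun l => by
    rw [hlaw l]; exact hF.aestronglyMeasurable.aemeasurable.inner_const
  have hid : ∀ l, IdentDistrib (fun ω => inner ℝ (F (Y l ω)) t) (fun ω => inner ℝ (F (Y 0 ω)) t)
      μ μ := fun l =>
    IdentDistrib.comp_of_aemeasurable (u := fun y => inner ℝ (F y) t) (f := Y l) (g := Y 0)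
      ⟨(hY l).aemeasurable, (hY 0).aemeasurable, by rw [hlaw l, hlaw 0]⟩ (hFm l)
  have hind : iIndepFun (fun l ω => inner ℝ (F (Y l ω)) t) μ :=
    hindep.comp₀ (fun _ y => inner ℝ (F y) t) (fun l => (hY l).aemeasurable) hFm
  have hLp : MemLp (fun y => inner ℝ (F y) t) 2 P := hF.inner_const t
  have hLp0 : MemLp (fun ω => inner ℝ (F (Y 0 ω)) t) 2 μ := by
    rw [← hlaw 0] at hLp
    exact hLp.comp_of_map (hY 0).aemeasurable
  have hmean : ∫ ω, inner ℝ (F (Y 0 ω)) t ∂μ = 0 := by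
    have h1 : ∫ y, inner ℝ (F y) t ∂P = 0 := by
      have := integral_inner (𝕜 := ℝ) (hF.integrable one_le_two) t
      rw [hF0, inner_zero_right] at this
      rw [← this]
      exact integral_congr_ae (.of_forall fun y => real_inner_comm _ _)
    rw [← h1, ← hlaw 0, integral_map (hY 0).aemeasurable]
    rw [hlaw 0]; exact hLp.aestronglyMeasurable
  have hvar : Var[fun ω => inner ℝ (F (Y 0 ω)) t; μ] = t ⬝ᵥ secondMoment P F *ᵥ t := by
    rw [variance_of_integral_eq_zero hLp0.aestronglyMeasurable.aemeasurable hmean,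
      secondMoment_quadratic hF, ← hlaw 0, integral_map (hY 0).aemeasurable]
    rw [hlaw 0]; exact hLp.aestronglyMeasurable.pow 2
  have hlim := tendsto_charFun_one_inv_sqrt_mul_sum hLp0 hmean hind hid
  rw [hvar] at hlim
  refine hlim.congr fun n => ?_
  simp [inner_smul_left, sum_inner]

variable [DecidableEq ι]

/-- The central limit theorem for centered random vectors. -/
theorem tendstoInDistribution_inv_sqrt_smul_sum {Ω : Type*} [MeasurableSpace Ω] {μ : Measure Ω}
    [IsProbabilityMeasure μ] {Y : ℕ → Ω → X}
    (hY : ∀ l, Measurable (Y l)) (hlaw : ∀ l, μ.map (Y l) = P) (hindep : iIndepFun Y μ)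
    (hF : MemLp F 2 P) (hF0 : ∫ y, F y ∂P = 0) :
    TendstoInDistribution (fun (n : ℕ) ω => (√(n : ℝ))⁻¹ • ∑ l ∈ Finset.range n, F (Y l ω))
      atTop id (fun _ => μ) (multivariateGaussian 0 (secondMoment P F)) := by
  have hP : IsProbabilityMeasure P := by
    rw [← hlaw 0]; exact Measure.isProbabilityMeasure_map (hY 0).aemeasurable
  have hFY : ∀ l, AEMeasurable (fun ω => F (Y l ω)) μ := fun l => by
    have : AEMeasurable F (μ.map (Y l)) := by
      rw [hlaw l]; exact hF.aestronglyMeasurable.aemeasurable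
    exact this.comp_measurable (hY l)
  have hSm : ∀ n : ℕ, AEMeasurable
      (fun ω => (√(n : ℝ))⁻¹ • ∑ l ∈ Finset.range n, F (Y l ω)) μ := fun n =>
    AEMeasurable.const_smul (g := fun ω => ∑ l ∈ Finset.range n, F (Y l ω))
      (Finset.aemeasurable_fun_sum _ fun l _ => hFY l) (√(n : ℝ))⁻¹
  refine ⟨hSm, aemeasurable_id, ?_⟩
  refine ProbabilityMeasure.tendsto_iff_tendsto_charFun.2 fun t => ?_
  simp only [ProbabilityMeasure.coe_mk, Measure.map_id,
    charFun_multivariateGaussian (posSemidef_secondMoment hF)]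
  simp_rw [charFun_map_eq_charFun_map_inner (hSm _)]
  convert! tendsto_charFun_inner_inv_sqrt_smul_sum hY hlaw hindep hF hF0 t using 3
  simp [neg_div]

end CLT

/-! ### Asymptotic normality of roots of estimating equations -/

section EstimatingEquation

variable {Ω : Type*} [MeasurableSpace Ω] {μ : Measure Ω} [IsProbabilityMeasure μ]

/-- Random vectors that converge in distribution are bounded in probability. -/
theorem exists_forall_measure_norm_gt_le {E : Type*} [NormedAddCommGroup E]
    [InnerProductSpace ℝ E] [FiniteDimensional ℝ E] [MeasurableSpace E] [BorelSpace E]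
    {Z : ℕ → Ω → E} {ν : Measure E} [IsProbabilityMeasure ν]
    (hZ : TendstoInDistribution Z atTop id (fun _ => μ) ν) {ε : ENNReal} (hε : 0 < ε) :
    ∃ R : ℝ, 0 ≤ R ∧ ∀ n, μ {ω | R < ‖Z n ω‖} ≤ ε := by
  have hlim := ProbabilityMeasure.tendsto_iff_tendsto_charFun.1 hZ.tendsto
  have hprob : ∀ n, IsProbabilityMeasure (μ.map (Z n)) := fun n =>
    Measure.isProbabilityMeasure_map (hZ.forall_aemeasurable n)
  -- Convergence of characteristic functions to a limit continuous at 0 gives tightness, hence one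
  -- radius R for all n.
  have htight := isTightMeasureSet_of_tendsto_charFun (μ := fun n => μ.map (Z n))
    (f := charFun ν) (by fun_prop) (by simpa using hlim)
  obtain ⟨K, hK, hKε⟩ := isTightMeasureSet_iff_exists_isCompact_measure_compl_le.1 htight ε hε
  obtain ⟨R, hR⟩ := hK.isBounded.exists_norm_le
  refine ⟨max R 0, le_max_right _ _, fun n => ?_⟩
  refine le_trans ?_ (hKε _ ⟨n, rfl⟩)
  rw [Measure.map_apply_of_aemeasurable (hZ.forall_aemeasurable n) hK.isClosed.measurableSet.compl]
  refine measure_mono fun ω hω hmem => ?_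
  exact absurd ((hR _ hmem).trans (le_max_left R 0)) (not_le.2 hω)

/-- If the difference of `D n` and `Z n` is negligible compared with `D n`, and `Z n` converges in
distribution, then the difference tends to zero in probability. -/
theorem tendsto_sub_inProb_of_norm_sub_le {E : Type*} [NormedAddCommGroup E]
    [InnerProductSpace ℝ E] [FiniteDimensional ℝ E] [MeasurableSpace E] [BorelSpace E]
    {D Z : ℕ → Ω → E} {ν : Measure E} [IsProbabilityMeasure ν]
    (hZ : TendstoInDistribution Z atTop id (fun _ => μ) ν)
    (h : ∀ η > 0, ∀ᶠ x : ℕ × Ω in inProb μ, ‖D x.1 x.2 - Z x.1 x.2‖ ≤ η * ‖D x.1 x.2‖) :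
    Tendsto (fun x : ℕ × Ω => D x.1 x.2 - Z x.1 x.2) (inProb μ) (𝓝 0) := by
  rw [Metric.tendsto_nhds]
  intro ε hε
  rw [eventually_inProb, ENNReal.tendsto_atTop_zero]
  intro δ hδ
  have hδ2 : 0 < δ / 2 := ENNReal.half_pos hδ.ne'
  obtain ⟨R, hR0, hR⟩ := exists_forall_measure_norm_gt_le hZ hδ2
  -- The factor 1/2 absorbs ‖D‖ into ‖Z‖ and yields ‖D‖ ≤ 2(R + 1); the second factor then bounds
  -- the difference by ε/2.
  have hη : 0 < min (1 / 2) (ε / (4 * (R + 1))) := by positivity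
  obtain ⟨N, hN⟩ := ENNReal.tendsto_atTop_zero.1 (eventually_inProb.1 (h _ hη)) _ hδ2
  refine ⟨N, fun n hn => ?_⟩
  calc μ {ω | ¬ dist (D n ω - Z n ω) 0 < ε}
      ≤ μ ({ω | R < ‖Z n ω‖} ∪
        {ω | ¬ ‖D n ω - Z n ω‖ ≤ min (1 / 2) (ε / (4 * (R + 1))) * ‖D n ω‖}) := by
        refine measure_mono fun ω hω => ?_
        by_contra hc
        simp only [Set.mem_union, Set.mem_ofPred_eq, not_or, not_not, not_lt] at hc
        obtain ⟨hZR, hle⟩ := hc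
        refine hω ?_
        rw [dist_zero_right]
        have hD0 := norm_nonneg (D n ω)
        have h1 : ‖D n ω - Z n ω‖ ≤ 1 / 2 * ‖D n ω‖ :=
          hle.trans (mul_le_mul_of_nonneg_right (min_le_left _ _) hD0)
        have h2 : ‖D n ω - Z n ω‖ ≤ ε / (4 * (R + 1)) * ‖D n ω‖ :=
          hle.trans (mul_le_mul_of_nonneg_right (min_le_right _ _) hD0)
        have h3 : ‖D n ω‖ ≤ ‖D n ω - Z n ω‖ + ‖Z n ω‖ := by
          simpa using norm_add_le (D n ω - Z n ω) (Z n ω)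
        have h4 : ‖D n ω‖ ≤ 2 * (R + 1) := by linarith
        calc ‖D n ω - Z n ω‖ ≤ ε / (4 * (R + 1)) * (2 * (R + 1)) :=
              h2.trans (mul_le_mul_of_nonneg_left h4 (by positivity))
          _ = ε / 2 := by field_simp; norm_num
          _ < ε := by linarith
    _ ≤ δ / 2 + δ / 2 := (measure_union_le _ _).trans (add_le_add (hR n) (hN n hn))
    _ = δ := ENNReal.add_halves δ

theorem tendstoInDistribution_of_norm_sub_le {E : Type*} [NormedAddCommGroup E]
    [InnerProductSpace ℝ E] [FiniteDimensional ℝ E] [MeasurableSpace E] [BorelSpace E]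
    {D Z : ℕ → Ω → E} {ν : Measure E} [IsProbabilityMeasure ν]
    (hZ : TendstoInDistribution Z atTop id (fun _ => μ) ν) (hD : ∀ n, AEMeasurable (D n) μ)
    (h : ∀ η > 0, ∀ᶠ x : ℕ × Ω in inProb μ, ‖D x.1 x.2 - Z x.1 x.2‖ ≤ η * ‖D x.1 x.2‖) :
    TendstoInDistribution D atTop id (fun _ => μ) ν :=
  tendstoInDistribution_of_tendstoInMeasure_sub D id hZ
    ((tendsto_inProb_iff (f := D - Z)).1 (tendsto_sub_inProb_of_norm_sub_le hZ h)) hD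

variable {X : Type*} [MeasurableSpace X] {P : Measure X} {Y : ℕ → Ω → X}
  {ι : Type*} [Fintype ι]

/-- The first-order expansion of the estimating function around `θ₀`, up to an error that is
negligible compared with `n * ‖θhat n - θ₀‖`. -/
theorem eventually_norm_score_expansion_le
    (hY : ∀ l, Measurable (Y l)) (hlaw : ∀ l, μ.map (Y l) = P) (hindep : iIndepFun Y μ)
    {ψ : X → EuclideanSpace ℝ ι → EuclideanSpace ℝ ι} {θ₀ : EuclideanSpace ℝ ι} {r : ℝ}
    (hr : 0 < r) (hmeas : ∀ θ ∈ Metric.ball θ₀ r, AEStronglyMeasurable (fun y => ψ y θ) P)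
    (hdiff : ∀ᵐ y ∂P, ∀ θ ∈ Metric.ball θ₀ r, DifferentiableAt ℝ (ψ y) θ)
    (hcont : ∀ᵐ y ∂P, ContinuousOn (fderiv ℝ (ψ y)) (Metric.ball θ₀ r))
    {d : X → ℝ} (hd : Integrable d P)
    (hbound : ∀ᵐ y ∂P, ∀ θ ∈ Metric.ball θ₀ r, ‖fderiv ℝ (ψ y) θ‖ ≤ d y)
    {θhat : ℕ → Ω → EuclideanSpace ℝ ι}
    (hcons : Tendsto (fun x : ℕ × Ω => θhat x.1 x.2) (inProb μ) (𝓝 θ₀)) {η : ℝ} (hη : 0 < η) :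
    ∀ᶠ x : ℕ × Ω in inProb μ,
      ‖∑ l ∈ Finset.range x.1, ψ (Y l x.2) (θhat x.1 x.2) -
        ∑ l ∈ Finset.range x.1, ψ (Y l x.2) θ₀ -
        (x.1 : ℝ) • (∫ y, fderiv ℝ (ψ y) θ₀ ∂P) (θhat x.1 x.2 - θ₀)‖
      ≤ x.1 * (η * ‖θhat x.1 x.2 - θ₀‖) := by
  have hθ₀ : θ₀ ∈ Metric.ball θ₀ r := Metric.mem_ball_self hr
  have hmeas' : ∀ θ ∈ Metric.ball θ₀ r,
      AEStronglyMeasurable (fun y => fderiv ℝ (ψ y) θ) P := fun θ hθ =>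
    aestronglyMeasurable_fderiv_param (Metric.isOpen_ball.mem_nhds hθ) hmeas
      (hdiff.mono fun y hy => hy θ hθ)
  -- Half of η pays for the variation of the derivative near θ₀, the other half for replacing its
  -- sample mean by its expectation.
  obtain ⟨δ, hδ, w, hw, hwη, hwb⟩ := exists_integrable_modulus
    (f := fun y θ => fderiv ℝ (ψ y) θ) hθ₀ hmeas' hcont hd hbound (half_pos hη)
  have hH : Integrable (fun y => fderiv ℝ (ψ y) θ₀) P :=
    hd.mono' (hmeas' θ₀ hθ₀) (hbound.mono fun y hy => hy θ₀ hθ₀)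
  have hHlim := (tendsto_average_inProb hY hlaw hindep hH).sub_const (∫ y, fderiv ℝ (ψ y) θ₀ ∂P)
  rw [sub_self] at hHlim
  have hHev := hHlim.norm.eventually_lt_const (u := η / 2) (by simpa using hη)
  filter_upwards [hHev, eventually_sum_le hY hlaw hindep hw hwη,
    eventually_inProb_of_ae (ae_sample hY hlaw hwb),
    eventually_inProb_of_ae (ae_sample hY hlaw hdiff),
    hcons (Metric.ball_mem_nhds θ₀ (lt_min hδ hr)),
    tendsto_fst_inProb.eventually_gt_atTop 0] with ⟨n, ω⟩ hHn hwn hwY hdY hθ hn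
  simp only at hHn hwn hwY hdY hθ hn ⊢
  have hθ' : θhat n ω ∈ Metric.ball θ₀ (min δ r) := hθ
  have hn' : (0 : ℝ) < n := by exact_mod_cast hn
  set Δ := θhat n ω - θ₀ with hΔ
  set H := ∫ y, fderiv ℝ (ψ y) θ₀ ∂P
  have hterm : ∀ l, ‖ψ (Y l ω) (θhat n ω) - ψ (Y l ω) θ₀ - fderiv ℝ (ψ (Y l ω)) θ₀ Δ‖
      ≤ w (Y l ω) * ‖Δ‖ := by
    intro l
    -- Mean value inequality for ψ minus its linearization at θ₀, whose derivative is bounded by the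
    -- modulus `w`.
    refine (convex_ball θ₀ (min δ r)).norm_image_sub_le_of_norm_fderiv_le' (𝕜 := ℝ)
      (fun θ h => hdY l θ (Metric.ball_subset_ball (min_le_right _ _) h)) (fun θ h => ?_)
      (Metric.mem_ball_self (lt_min hδ hr)) hθ'
    exact hwY l θ ⟨Metric.ball_subset_ball (min_le_right _ _) h,
      Metric.ball_subset_ball (min_le_left _ _) h⟩
  have hsum : ‖∑ l ∈ Finset.range n, ψ (Y l ω) (θhat n ω) - ∑ l ∈ Finset.range n, ψ (Y l ω) θ₀ -
      (∑ l ∈ Finset.range n, fderiv ℝ (ψ (Y l ω)) θ₀) Δ‖ ≤ n * (η / 2) * ‖Δ‖ := by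
    have hs : (∑ l ∈ Finset.range n, fderiv ℝ (ψ (Y l ω)) θ₀) Δ =
        ∑ l ∈ Finset.range n, fderiv ℝ (ψ (Y l ω)) θ₀ Δ := by simp
    rw [hs, ← Finset.sum_sub_distrib, ← Finset.sum_sub_distrib]
    refine (norm_sum_le_of_le _ fun l _ => hterm l).trans ?_
    rw [← Finset.sum_mul]
    exact mul_le_mul_of_nonneg_right hwn (norm_nonneg _)
  have hHsum : ‖(∑ l ∈ Finset.range n, fderiv ℝ (ψ (Y l ω)) θ₀) Δ - (n : ℝ) • H Δ‖
      ≤ n * (η / 2) * ‖Δ‖ := by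
    have : (∑ l ∈ Finset.range n, fderiv ℝ (ψ (Y l ω)) θ₀) Δ - (n : ℝ) • H Δ =
        (n : ℝ) • (((n : ℝ)⁻¹ • ∑ l ∈ Finset.range n, fderiv ℝ (ψ (Y l ω)) θ₀) - H) Δ := by
      rw [sub_apply, smul_apply, smul_sub,
        smul_inv_smul₀ hn'.ne']
    rw [this, norm_smul, Real.norm_of_nonneg hn'.le, mul_assoc]
    refine mul_le_mul_of_nonneg_left ?_ hn'.le
    exact (ContinuousLinearMap.le_opNorm _ _).trans
      (mul_le_mul_of_nonneg_right hHn.le (norm_nonneg _))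
  refine (norm_sub_le_norm_sub_add_norm_sub _
    ((∑ l ∈ Finset.range n, fderiv ℝ (ψ (Y l ω)) θ₀) Δ) _).trans ?_
  refine (add_le_add hsum hHsum).trans (le_of_eq (by ring))

/-- Consistent roots of an estimating equation are asymptotically normal. -/
theorem tendstoInDistribution_of_score_eq_zero [DecidableEq ι]
    (hY : ∀ l, Measurable (Y l)) (hlaw : ∀ l, μ.map (Y l) = P) (hindep : iIndepFun Y μ)
    {ψ : X → EuclideanSpace ℝ ι → EuclideanSpace ℝ ι} {θ₀ : EuclideanSpace ℝ ι} {r : ℝ}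
    (hr : 0 < r) (hmeas : ∀ θ ∈ Metric.ball θ₀ r, AEStronglyMeasurable (fun y => ψ y θ) P)
    (hdiff : ∀ᵐ y ∂P, ∀ θ ∈ Metric.ball θ₀ r, DifferentiableAt ℝ (ψ y) θ)
    (hcont : ∀ᵐ y ∂P, ContinuousOn (fderiv ℝ (ψ y)) (Metric.ball θ₀ r))
    {d : X → ℝ} (hd : Integrable d P)
    (hbound : ∀ᵐ y ∂P, ∀ θ ∈ Metric.ball θ₀ r, ‖fderiv ℝ (ψ y) θ‖ ≤ d y)
    (hL2 : MemLp (fun y => ψ y θ₀) 2 P) (hmean : ∫ y, ψ y θ₀ ∂P = 0)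
    {G : EuclideanSpace ℝ ι →L[ℝ] EuclideanSpace ℝ ι}
    (hG : ∀ v, G ((∫ y, fderiv ℝ (ψ y) θ₀ ∂P) v) = -v)
    {θhat : ℕ → Ω → EuclideanSpace ℝ ι} (hθm : ∀ n, AEMeasurable (θhat n) μ)
    (hcons : Tendsto (fun x : ℕ × Ω => θhat x.1 x.2) (inProb μ) (𝓝 θ₀))
    (hscore : ∀ᶠ x : ℕ × Ω in inProb μ,
      ∑ l ∈ Finset.range x.1, ψ (Y l x.2) (θhat x.1 x.2) = 0) :
    TendstoInDistribution (fun (n : ℕ) ω => √(n : ℝ) • (θhat n ω - θ₀)) atTop id (fun _ => μ)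
      (multivariateGaussian 0 (secondMoment P fun y => G (ψ y θ₀))) := by
  have hP : IsProbabilityMeasure P := by
    rw [← hlaw 0]; exact Measure.isProbabilityMeasure_map (hY 0).aemeasurable
  have hZ := tendstoInDistribution_inv_sqrt_smul_sum (F := fun y => G (ψ y θ₀)) hY hlaw hindep
    (G.comp_memLp' hL2) (by
      rw [ContinuousLinearMap.integral_comp_comm _ (hL2.integrable one_le_two), hmean, map_zero])
  have hDm : ∀ n : ℕ, AEMeasurable (fun ω => √(n : ℝ) • (θhat n ω - θ₀)) μ := fun n =>
    ((continuous_id.sub continuous_const).const_smul √(n : ℝ)).measurable.comp_aemeasurable (hθm n)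
  refine tendstoInDistribution_of_norm_sub_le hZ hDm fun η hη => ?_
  -- Applying `G` costs a factor ‖G‖; the added 1 keeps the divisor positive when `G` is zero.
  have hη' : 0 < η / (‖G‖ + 1) := by positivity
  filter_upwards [eventually_norm_score_expansion_le hY hlaw hindep hr hmeas hdiff hcont hd hbound
    hcons hη', hscore, tendsto_fst_inProb.eventually_gt_atTop 0] with ⟨n, ω⟩ hexp hs hn
  simp only at hexp hs hn ⊢
  have hn' : (0 : ℝ) < n := by exact_mod_cast hn
  have hsq : 0 < √(n : ℝ) := Real.sqrt_pos.2 hn'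
  set Δ := θhat n ω - θ₀
  set S := ∑ l ∈ Finset.range n, ψ (Y l ω) θ₀ with hS
  have hGS : ∑ l ∈ Finset.range n, G (ψ (Y l ω) θ₀) = G S := (map_sum G _ _).symm
  -- Since `G` inverts the mean derivative up to sign, the difference is `G` of the expansion error,
  -- where 0 stands for the score at the estimator.
  have hdec : √(n : ℝ) • Δ - (√(n : ℝ))⁻¹ • G S =
      (√(n : ℝ))⁻¹ • G (0 - S - (n : ℝ) • (∫ y, fderiv ℝ (ψ y) θ₀ ∂P) Δ) := by
    rw [zero_sub, map_sub, map_neg, map_smul, hG]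
    have : (√(n : ℝ))⁻¹ * n = √(n : ℝ) := by
      rw [inv_mul_eq_iff_eq_mul₀ hsq.ne', Real.mul_self_sqrt hn'.le]
    rw [smul_neg, sub_neg_eq_add, smul_add, smul_neg, smul_smul, this]
    abel
  rw [hs] at hexp
  rw [hGS, hdec, norm_smul, norm_smul, Real.norm_of_nonneg hsq.le,
    Real.norm_of_nonneg (inv_nonneg.2 hsq.le), inv_mul_le_iff₀ hsq]
  calc _ ≤ ‖G‖ * (n * (η / (‖G‖ + 1) * ‖Δ‖)) :=
        (G.le_opNorm _).trans (mul_le_mul_of_nonneg_left hexp (norm_nonneg _))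
    _ ≤ (‖G‖ + 1) * (n * (η / (‖G‖ + 1) * ‖Δ‖)) := by gcongr; linarith
    _ = n * (η * ‖Δ‖) := by field_simp
    _ = √(n : ℝ) * (η * (√(n : ℝ) * ‖Δ‖)) := by
        nth_rewrite 1 [← Real.mul_self_sqrt hn'.le]; ring

end EstimatingEquation

/-! ### Consistency of approximate maximizers -/

theorem concaveOn_finsetSum {α : Type*} {E : Type*} [NormedAddCommGroup E] [NormedSpace ℝ E]
    (s : Finset α) {f : α → E → ℝ} {C : Set E}
    (hC : Convex ℝ C) (h : ∀ i ∈ s, ConcaveOn ℝ C (f i)) :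
    ConcaveOn ℝ C fun θ => ∑ i ∈ s, f i θ := by
  classical
  induction s using Finset.induction_on with
  | empty => simpa using concaveOn_const (0 : ℝ) hC
  | insert a s ha ih =>
    simp_rw [Finset.sum_insert ha]
    exact (h a (Finset.mem_insert_self _ _)).add (ih fun i hi => h i (Finset.mem_insert_of_mem hi))

theorem exists_mem_segment_sphere {E : Type*} [NormedAddCommGroup E] [NormedSpace ℝ E] {a b : E} {r : ℝ}
    (hr : 0 < r) (h : r ≤ dist b a) :
    ∃ z ∈ segment ℝ a b, z ∈ Metric.sphere a r := by
  have hb : 0 < dist b a := hr.trans_le h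
  refine ⟨AffineMap.lineMap a b (r / dist b a), ?_, ?_⟩
  · rw [segment_eq_image_lineMap]
    exact ⟨_, ⟨by positivity, (div_le_one hb).2 h⟩, rfl⟩
  · rw [Metric.mem_sphere, dist_lineMap_left, Real.norm_of_nonneg (by positivity), dist_comm a b,
      div_mul_cancel₀ _ hb.ne']

section Consistency

variable {Ω : Type*} [MeasurableSpace Ω] {μ : Measure Ω} [IsProbabilityMeasure μ]
  {X : Type*} [MeasurableSpace X] {P : Measure X} {Y : ℕ → Ω → X}
  {E : Type*} [NormedAddCommGroup E] [NormedSpace ℝ E] [FiniteDimensional ℝ E]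
  {m : X → E → ℝ} {Θ : Set E} {θ₀ : E} {θhat : ℕ → Ω → E}

/-- Wald's argument: if, whenever the estimator is far from `θ₀`, the criterion takes on a compact
set without `θ₀` a value that is not below both its value at `θ₀` and at the estimator, then the
estimator is close to `θ₀`. -/
theorem eventually_dist_lt_of_isCompact
    (hY : ∀ l, Measurable (Y l)) (hlaw : ∀ l, μ.map (Y l) = P) (hindep : iIndepFun Y μ)
    (hθ₀ : θ₀ ∈ Θ) (hmeas : ∀ θ ∈ Θ, AEMeasurable (fun y => m y θ) P)
    (hcont : ∀ᵐ y ∂P, ContinuousOn (m y) Θ)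
    (hdom : ∀ K ⊆ Θ, IsCompact K → ∃ d : X → ℝ, Integrable d P ∧ ∀ᵐ y ∂P, ∀ θ ∈ K, |m y θ| ≤ d y)
    (hmax : ∀ θ ∈ Θ, θ ≠ θ₀ → ∫ y, m y θ ∂P < ∫ y, m y θ₀ ∂P)
    (hnear : ∀ ε : ℝ, 0 < ε → ∀ᶠ x : ℕ × Ω in inProb μ, ∀ θ ∈ Θ,
      ∑ l ∈ Finset.range x.1, m (Y l x.2) θ ≤
        ∑ l ∈ Finset.range x.1, m (Y l x.2) (θhat x.1 x.2) + x.1 * ε)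
    {r : ℝ} {K : Set E} (hK : IsCompact K) (hKΘ : K ⊆ Θ) (hKθ₀ : θ₀ ∉ K)
    (hfar : ∀ᶠ x : ℕ × Ω in inProb μ, r ≤ dist (θhat x.1 x.2) θ₀ → ∃ θ ∈ K,
      min (∑ l ∈ Finset.range x.1, m (Y l x.2) θ₀)
        (∑ l ∈ Finset.range x.1, m (Y l x.2) (θhat x.1 x.2)) ≤
      ∑ l ∈ Finset.range x.1, m (Y l x.2) θ) :
    ∀ᶠ x : ℕ × Ω in inProb μ, dist (θhat x.1 x.2) θ₀ < r := by
  obtain ⟨d, hd, hdb⟩ := hdom K hKΘ hK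
  obtain ⟨ε, hε, hsup⟩ := exists_eventually_sum_le_of_isCompact hY hlaw hindep hK
    (fun θ hθ => hmeas θ (hKΘ hθ)) (hcont.mono fun y hy => hy.mono hKΘ) hd hdb
    (fun θ hθ => hmax θ (hKΘ hθ) (ne_of_mem_of_not_mem hθ hKθ₀))
  obtain ⟨d₀, hd₀, hdb₀⟩ := hdom {θ₀} (Set.singleton_subset_iff.2 hθ₀) isCompact_singleton
  have hm₀ : Integrable (fun y => m y θ₀) P :=
    hd₀.mono' (hmeas θ₀ hθ₀).aestronglyMeasurable (hdb₀.mono fun y hy => hy θ₀ rfl)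
  -- The law of large numbers for -m bounds the sum at θ₀ below with loss nε/4. Near maximality
  -- costs nε/2 more, so both values compared in `hfar` stay above the bound n(E m(θ₀) - ε) on K.
  have hlow := eventually_sum_le hY hlaw hindep hm₀.neg (c := -(∫ y, m y θ₀ ∂P) + ε / 4) (by
    simp only [Pi.neg_apply]; rw [integral_neg]; linarith)
  filter_upwards [hsup, hlow, hnear (ε / 2) (half_pos hε), hfar,
    tendsto_fst_inProb.eventually_gt_atTop 0] with ⟨n, ω⟩ h1 h2 h3 h4 hn
  by_contra! hcon
  obtain ⟨θ, hθ, hle⟩ := h4 hcon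
  have hn' : (0 : ℝ) < n := by exact_mod_cast hn
  have h5 := h1 θ hθ
  have h6 := h3 θ₀ hθ₀
  simp only [Pi.neg_apply, Finset.sum_neg_distrib] at h2 h5 h6 hle
  have hnε : 0 < n * ε := mul_pos hn' hε
  rcases min_le_iff.1 hle with h | h <;> nlinarith

theorem tendsto_inProb_of_isCompact
    (hY : ∀ l, Measurable (Y l)) (hlaw : ∀ l, μ.map (Y l) = P) (hindep : iIndepFun Y μ)
    (hθ₀ : θ₀ ∈ Θ) (hmeas : ∀ θ ∈ Θ, AEMeasurable (fun y => m y θ) P)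
    (hcont : ∀ᵐ y ∂P, ContinuousOn (m y) Θ)
    (hdom : ∀ K ⊆ Θ, IsCompact K → ∃ d : X → ℝ, Integrable d P ∧ ∀ᵐ y ∂P, ∀ θ ∈ K, |m y θ| ≤ d y)
    (hmax : ∀ θ ∈ Θ, θ ≠ θ₀ → ∫ y, m y θ ∂P < ∫ y, m y θ₀ ∂P)
    (hmem : ∀ᶠ x : ℕ × Ω in inProb μ, θhat x.1 x.2 ∈ Θ)
    (hnear : ∀ ε : ℝ, 0 < ε → ∀ᶠ x : ℕ × Ω in inProb μ, ∀ θ ∈ Θ,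
      ∑ l ∈ Finset.range x.1, m (Y l x.2) θ ≤
        ∑ l ∈ Finset.range x.1, m (Y l x.2) (θhat x.1 x.2) + x.1 * ε)
    (hΘ : IsCompact Θ) :
    Tendsto (fun x : ℕ × Ω => θhat x.1 x.2) (inProb μ) (𝓝 θ₀) := by
  rw [Metric.tendsto_nhds]
  intro r hr
  -- A distant estimator lies in Θ without the ball and is its own witness.
  refine eventually_dist_lt_of_isCompact hY hlaw hindep hθ₀ hmeas hcont hdom hmax hnear
    (hΘ.diff Metric.isOpen_ball) Set.sdiff_subset (fun h => h.2 (Metric.mem_ball_self hr)) ?_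
  filter_upwards [hmem] with x hx hfar
  exact ⟨_, ⟨hx, fun h => not_le.2 (Metric.mem_ball.1 h) hfar⟩, min_le_right _ _⟩

theorem tendsto_inProb_of_concaveOn
    (hY : ∀ l, Measurable (Y l)) (hlaw : ∀ l, μ.map (Y l) = P) (hindep : iIndepFun Y μ)
    (hθ₀ : θ₀ ∈ interior Θ) (hmeas : ∀ θ ∈ Θ, AEMeasurable (fun y => m y θ) P)
    (hcont : ∀ᵐ y ∂P, ContinuousOn (m y) Θ)
    (hdom : ∀ K ⊆ Θ, IsCompact K → ∃ d : X → ℝ, Integrable d P ∧ ∀ᵐ y ∂P, ∀ θ ∈ K, |m y θ| ≤ d y)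
    (hmax : ∀ θ ∈ Θ, θ ≠ θ₀ → ∫ y, m y θ ∂P < ∫ y, m y θ₀ ∂P)
    (hmem : ∀ᶠ x : ℕ × Ω in inProb μ, θhat x.1 x.2 ∈ Θ)
    (hnear : ∀ ε : ℝ, 0 < ε → ∀ᶠ x : ℕ × Ω in inProb μ, ∀ θ ∈ Θ,
      ∑ l ∈ Finset.range x.1, m (Y l x.2) θ ≤
        ∑ l ∈ Finset.range x.1, m (Y l x.2) (θhat x.1 x.2) + x.1 * ε)
    (hΘ : Convex ℝ Θ) (hconc : ∀ᵐ y ∂P, ConcaveOn ℝ Θ (m y)) :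
    Tendsto (fun x : ℕ × Ω => θhat x.1 x.2) (inProb μ) (𝓝 θ₀) := by
  have hθ₀' := interior_subset hθ₀
  rw [Metric.tendsto_nhds]
  intro r hr
  obtain ⟨r₁, hr₁, hball⟩ := Metric.nhds_basis_closedBall.mem_iff.1 (mem_interior_iff_mem_nhds.1 hθ₀)
  have hr' : 0 < min r r₁ := lt_min hr hr₁
  refine (eventually_dist_lt_of_isCompact (r := min r r₁) hY hlaw hindep hθ₀' hmeas hcont hdom hmax
    hnear (isCompact_sphere θ₀ (min r r₁)) ?_ ?_ ?_).mono fun x hx => hx.trans_le (min_le_left _ _)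
  · exact (Metric.sphere_subset_closedBall.trans
      (Metric.closedBall_subset_closedBall (min_le_right _ _))).trans hball
  · simp [hr'.ne]
  · filter_upwards [hmem, eventually_inProb_of_ae (ae_sample hY hlaw hconc)] with x hx hc hfar
    -- The segment from θ₀ to a distant estimator crosses the sphere, and there the concave sum is
    -- at least the minimum of its end values.
    obtain ⟨z, hz, hzs⟩ := exists_mem_segment_sphere hr' hfar
    exact ⟨z, hzs, (concaveOn_finsetSum _ hΘ fun l _ => hc l).min_le_of_mem_segment hθ₀' hx hz⟩

end Consistency

/-! ### Asymptotic normality of M-estimators -/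

section MEstimator

theorem norm_gradient_eq {E : Type*} [NormedAddCommGroup E] [InnerProductSpace ℝ E]
    [CompleteSpace E] (f : E → ℝ) (θ : E) : ‖gradient f θ‖ = ‖fderiv ℝ f θ‖ :=
  (InnerProductSpace.toDual ℝ E).symm.norm_map _

theorem ContDiffOn.gradient_of_isOpen {E : Type*} [NormedAddCommGroup E] [InnerProductSpace ℝ E]
    [CompleteSpace E] {f : E → ℝ} {U : Set E} (hf : ContDiffOn ℝ 2 f U) (hU : IsOpen U) :
    ContDiffOn ℝ 1 (gradient f) U :=
  ((InnerProductSpace.toDual ℝ E).symm.toContinuousLinearEquiv.contDiff (n := 1)).comp_contDiffOn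
    (hf.fderiv_of_isOpen hU (by norm_num))

/-- The score vanishes at an interior maximizer. -/
theorem sum_gradient_eq_zero_of_isLocalMax {α E : Type*} [NormedAddCommGroup E]
    [InnerProductSpace ℝ E] [CompleteSpace E] {s : Finset α} {f : α → E → ℝ} {θ : E}
    (hd : ∀ i ∈ s, DifferentiableAt ℝ (f i) θ)
    (hmax : IsLocalMax (fun θ => ∑ i ∈ s, f i θ) θ) : ∑ i ∈ s, gradient (f i) θ = 0 := by
  have h := hmax.fderiv_eq_zero
  rw [fderiv_fun_sum hd] at h
  simp only [gradient]
  rw [← map_sum, h, map_zero]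

variable {X : Type*} [MeasurableSpace X] {P : Measure X}

/-- Differentiation under the integral sign: the score has mean zero at a maximizer of the expected
criterion. -/
theorem integral_gradient_eq_zero_of_isLocalMax {E : Type*} [NormedAddCommGroup E]
    [InnerProductSpace ℝ E] [FiniteDimensional ℝ E] {m : X → E → ℝ} {θ₀ : E} {r : ℝ} (hr : 0 < r)
    (hmeas : ∀ θ ∈ Metric.ball θ₀ r, AEStronglyMeasurable (fun y => m y θ) P)
    (hint : Integrable (fun y => m y θ₀) P)
    (hC2 : ∀ᵐ y ∂P, ContDiffOn ℝ 2 (m y) (Metric.ball θ₀ r))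
    {d : X → ℝ} (hd : Integrable d P)
    (hbound : ∀ᵐ y ∂P, ∀ θ ∈ Metric.ball θ₀ r, ‖fderiv ℝ (gradient (m y)) θ‖ ≤ d y)
    (hint' : Integrable (fun y => gradient (m y) θ₀) P)
    (hmax : IsLocalMax (fun θ => ∫ y, m y θ ∂P) θ₀) :
    ∫ y, gradient (m y) θ₀ ∂P = 0 := by
  have hθ₀ : θ₀ ∈ Metric.ball θ₀ r := Metric.mem_ball_self hr
  have hdiff : ∀ᵐ y ∂P, ∀ θ ∈ Metric.ball θ₀ r, DifferentiableAt ℝ (m y) θ :=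
    hC2.mono fun y hy θ hθ =>
      (hy.differentiableOn two_ne_zero).differentiableAt (Metric.isOpen_ball.mem_nhds hθ)
  have hder := hasFDerivAt_integral_of_dominated_of_fderiv_le (F := fun θ y => m y θ)
    (F' := fun θ y => fderiv ℝ (m y) θ) (μ := P) (𝕜 := ℝ)
    -- By the mean value inequality the gradient on the ball exceeds its norm at θ₀ by at most the
    -- Hessian bound times the radius.
    (bound := fun y => ‖gradient (m y) θ₀‖ + d y * r)
    (Metric.ball_mem_nhds θ₀ hr)
    (by filter_upwards [Metric.ball_mem_nhds θ₀ hr] with θ hθ using hmeas θ hθ) hint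
    (aestronglyMeasurable_fderiv_param (Metric.ball_mem_nhds θ₀ hr) hmeas
      (hdiff.mono fun y hy => hy θ₀ hθ₀)) ?_ (hint'.norm.add (hd.mul_const r)) ?_
  · have h0 := hmax.hasFDerivAt_eq_zero hder
    have h1 : ∀ y, gradient (m y) θ₀ =
        (InnerProductSpace.toDual ℝ E).symm.toContinuousLinearEquiv (fderiv ℝ (m y) θ₀) :=
      fun y => rfl
    simp_rw [h1]
    rw [ContinuousLinearEquiv.integral_comp_comm, h0, map_zero]
  · filter_upwards [hC2, hbound] with y hy hb θ hθ
    rw [← norm_gradient_eq]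
    have hd0 : 0 ≤ d y := (norm_nonneg _).trans (hb θ₀ hθ₀)
    have hg := (convex_ball θ₀ r).norm_image_sub_le_of_norm_fderiv_le (𝕜 := ℝ)
      (fun θ' h => ((hy.gradient_of_isOpen Metric.isOpen_ball).differentiableOn
        one_ne_zero).differentiableAt (Metric.isOpen_ball.mem_nhds h)) hb hθ₀ hθ
    have h2 : d y * ‖θ - θ₀‖ ≤ d y * r :=
      mul_le_mul_of_nonneg_left (mem_ball_iff_norm.1 hθ).le hd0
    have h3 : ‖gradient (m y) θ‖ ≤ ‖gradient (m y) θ - gradient (m y) θ₀‖ + ‖gradient (m y) θ₀‖ := by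
      simpa using norm_add_le (gradient (m y) θ - gradient (m y) θ₀) (gradient (m y) θ₀)
    linarith
  · exact hdiff.mono fun y hy θ hθ => (hy θ hθ).hasFDerivAt

theorem aestronglyMeasurable_gradient_param {E : Type*} [NormedAddCommGroup E]
    [InnerProductSpace ℝ E] [FiniteDimensional ℝ E] {m : X → E → ℝ} {U : Set E} {θ : E}
    (hU : U ∈ 𝓝 θ) (hmeas : ∀ θ' ∈ U, AEStronglyMeasurable (fun y => m y θ') P)
    (hdiff : ∀ᵐ y ∂P, DifferentiableAt ℝ (m y) θ) :
    AEStronglyMeasurable (fun y => gradient (m y) θ) P :=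
  (InnerProductSpace.toDual ℝ E).symm.continuous.comp_aestronglyMeasurable
    (aestronglyMeasurable_fderiv_param hU hmeas hdiff)

/-- Measurability passes from the criterion to its gradient and from the gradient to the Hessian,
each time through difference quotients. -/
theorem integrable_fderiv_gradient {E : Type*} [NormedAddCommGroup E]
    [InnerProductSpace ℝ E] [FiniteDimensional ℝ E] {m : X → E → ℝ} {U : Set E} {θ₀ : E}
    (hU : IsOpen U) (hθ₀ : θ₀ ∈ U) (hmeas : ∀ θ ∈ U, AEStronglyMeasurable (fun y => m y θ) P)
    (hC2 : ∀ᵐ y ∂P, ContDiffOn ℝ 2 (m y) U) {d : X → ℝ} (hd : Integrable d P)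
    (hbound : ∀ᵐ y ∂P, ∀ θ ∈ U, ‖fderiv ℝ (gradient (m y)) θ‖ ≤ d y) :
    Integrable (fun y => fderiv ℝ (gradient (m y)) θ₀) P := by
  refine hd.mono' ?_ (hbound.mono fun y hy => hy θ₀ hθ₀)
  refine aestronglyMeasurable_fderiv_param (hU.mem_nhds hθ₀) (fun θ hθ => ?_) (hC2.mono fun y hy =>
    ((hy.gradient_of_isOpen hU).differentiableOn one_ne_zero).differentiableAt (hU.mem_nhds hθ₀))
  exact aestronglyMeasurable_gradient_param (hU.mem_nhds hθ) hmeas (hC2.mono fun y hy =>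
    (hy.differentiableOn two_ne_zero).differentiableAt (hU.mem_nhds hθ))

variable {Ω : Type*} [MeasurableSpace Ω] {μ : Measure Ω} [IsProbabilityMeasure μ] {Y : ℕ → Ω → X}
  {ι : Type*} [Fintype ι] [DecidableEq ι]

/-- Consistent M-estimators are asymptotically normal. -/
theorem tendstoInDistribution_of_mEstimator
    (hY : ∀ l, Measurable (Y l)) (hlaw : ∀ l, μ.map (Y l) = P) (hindep : iIndepFun Y μ)
    {m : X → EuclideanSpace ℝ ι → ℝ} {Θ : Set (EuclideanSpace ℝ ι)} {θ₀ : EuclideanSpace ℝ ι}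
    (hθ₀ : θ₀ ∈ interior Θ) (hmeas : ∀ θ ∈ Θ, AEMeasurable (fun y => m y θ) P)
    (hint : Integrable (fun y => m y θ₀) P)
    (hmax : ∀ θ ∈ Θ, θ ≠ θ₀ → ∫ y, m y θ ∂P < ∫ y, m y θ₀ ∂P)
    {U : Set (EuclideanSpace ℝ ι)} (hU : IsOpen U) (hθ₀U : θ₀ ∈ U)
    (hC2 : ∀ᵐ y ∂P, ContDiffOn ℝ 2 (m y) U) {d : X → ℝ} (hd : Integrable d P)
    (hbound : ∀ᵐ y ∂P, ∀ θ ∈ U, ‖fderiv ℝ (gradient (m y)) θ‖ ≤ d y)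
    (hL2 : MemLp (fun y => gradient (m y) θ₀) 2 P)
    {G : EuclideanSpace ℝ ι →L[ℝ] EuclideanSpace ℝ ι}
    (hG : ∀ v, G ((∫ y, fderiv ℝ (gradient (m y)) θ₀ ∂P) v) = -v)
    {θhat : ℕ → Ω → EuclideanSpace ℝ ι} (hθm : ∀ n, AEMeasurable (θhat n) μ)
    (hcons : Tendsto (fun x : ℕ × Ω => θhat x.1 x.2) (inProb μ) (𝓝 θ₀))
    (hsolves : ∀ᶠ x : ℕ × Ω in inProb μ,
      ∑ l ∈ Finset.range x.1, gradient (m (Y l x.2)) (θhat x.1 x.2) = 0 ∨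
        IsMaxOn (fun θ => ∑ l ∈ Finset.range x.1, m (Y l x.2) θ) Θ (θhat x.1 x.2)) :
    TendstoInDistribution (fun (n : ℕ) ω => √(n : ℝ) • (θhat n ω - θ₀)) atTop id (fun _ => μ)
      (multivariateGaussian 0 (secondMoment P fun y => G (gradient (m y) θ₀))) := by
  have hP : IsProbabilityMeasure P := by
    rw [← hlaw 0]; exact Measure.isProbabilityMeasure_map (hY 0).aemeasurable
  -- The ball lies both in Θ, for measurability and maximality, and in `U`, for smoothness.
  obtain ⟨r, hr, hball⟩ := Metric.mem_nhds_iff.1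
    (inter_mem (mem_interior_iff_mem_nhds.1 hθ₀) (hU.mem_nhds hθ₀U))
  have hballU : Metric.ball θ₀ r ⊆ U := fun θ hθ => (hball hθ).2
  have hballΘ : Metric.ball θ₀ r ⊆ Θ := fun θ hθ => (hball hθ).1
  have hC2r : ∀ᵐ y ∂P, ContDiffOn ℝ 2 (m y) (Metric.ball θ₀ r) := hC2.mono fun y hy => hy.mono hballU
  have hC1r : ∀ᵐ y ∂P, ContDiffOn ℝ 1 (gradient (m y)) (Metric.ball θ₀ r) :=
    hC2r.mono fun y hy => hy.gradient_of_isOpen Metric.isOpen_ball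
  have hboundr : ∀ᵐ y ∂P, ∀ θ ∈ Metric.ball θ₀ r, ‖fderiv ℝ (gradient (m y)) θ‖ ≤ d y :=
    hbound.mono fun y hy θ hθ => hy θ (hballU hθ)
  have hdiff : ∀ᵐ y ∂P, ∀ θ ∈ Metric.ball θ₀ r, DifferentiableAt ℝ (m y) θ :=
    hC2r.mono fun y hy θ hθ =>
      (hy.differentiableOn two_ne_zero).differentiableAt (Metric.isOpen_ball.mem_nhds hθ)
  have hmr : ∀ θ ∈ Metric.ball θ₀ r, AEStronglyMeasurable (fun y => m y θ) P :=
    fun θ hθ => (hmeas θ (hballΘ hθ)).aestronglyMeasurable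
  have hlocmax : IsLocalMax (fun θ => ∫ y, m y θ ∂P) θ₀ := by
    filter_upwards [Metric.ball_mem_nhds θ₀ hr] with θ hθ
    rcases eq_or_ne θ θ₀ with rfl | hne
    · exact le_rfl
    · exact (hmax θ (hballΘ hθ) hne).le
  refine tendstoInDistribution_of_score_eq_zero (ψ := fun y => gradient (m y)) hY hlaw hindep hr
    (fun θ hθ => ?_) ?_ ?_ hd hboundr hL2 ?_ hG hθm hcons ?_
  · exact aestronglyMeasurable_gradient_param (Metric.isOpen_ball.mem_nhds hθ) hmr
      (hdiff.mono fun y hy => hy θ hθ)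
  · exact hC1r.mono fun y hy θ hθ =>
      (hy.differentiableOn one_ne_zero).differentiableAt (Metric.isOpen_ball.mem_nhds hθ)
  · exact hC1r.mono fun y hy => hy.continuousOn_fderiv_of_isOpen Metric.isOpen_ball le_rfl
  · exact integral_gradient_eq_zero_of_isLocalMax hr hmr hint hC2r hd hboundr
      (hL2.integrable one_le_two) hlocmax
  · filter_upwards [hsolves, hcons (Metric.ball_mem_nhds θ₀ hr),
      eventually_inProb_of_ae (ae_sample hY hlaw hdiff)] with x hx hxr hxd
    rcases hx with hx | hx
    · exact hx
    -- The ball around θ₀ is a neighbourhood of the estimator within Θ, so a maximizer over Θ is a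
    -- local maximizer.
    · exact sum_gradient_eq_zero_of_isLocalMax (fun l _ => hxd l _ hxr)
        (hx.isLocalMax (mem_of_superset (Metric.isOpen_ball.mem_nhds hxr) hballΘ))

end MEstimator

/-! ### Adaptive Gauss-Hermite estimators -/

/-- This gives the limiting covariance its sandwich form. -/
theorem secondMoment_toEuclideanCLM {ι : Type*} [Fintype ι] [DecidableEq ι] {X : Type*}
    [MeasurableSpace X] {P : Measure X} {F : X → EuclideanSpace ℝ ι} (hF : MemLp F 2 P)
    (C : Matrix ι ι ℝ) :
    secondMoment P (fun y => Matrix.toEuclideanCLM (𝕜 := ℝ) C (F y)) =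
      C * secondMoment P F * Cᵀ := by
  ext i j
  have h : ∀ y, Matrix.toEuclideanCLM (𝕜 := ℝ) C (F y) i *
      Matrix.toEuclideanCLM (𝕜 := ℝ) C (F y) j =
      ∑ b, ∑ a, C i a * C j b * (F y a * F y b) := by
    intro y
    simp only [Matrix.ofLp_toEuclideanCLM, Matrix.mulVec, dotProduct, Finset.sum_mul_sum]
    rw [Finset.sum_comm]
    exact Finset.sum_congr rfl fun b _ => Finset.sum_congr rfl fun a _ => by ring
  rw [secondMoment, Matrix.of_apply]
  simp_rw [h]
  rw [integral_finsetSum _ fun b _ => integrable_finsetSum _ fun a _ =>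
    (integrable_mul_apply hF a b).const_mul _]
  simp only [Matrix.mul_apply, Matrix.transpose_apply, Finset.sum_mul]
  refine Finset.sum_congr rfl fun b _ => ?_
  rw [integral_finsetSum _ fun a _ => (integrable_mul_apply hF a b).const_mul _]
  refine Finset.sum_congr rfl fun a _ => ?_
  rw [integral_const_mul, secondMoment, Matrix.of_apply]
  ring

/-- `matB` integrates entry by entry, the expansion integrates operators; integrability lets
evaluation at basis vectors and coordinates pass under the integral. -/
theorem toEuclideanCLM_matB {p q k : ℕ} (M : GLLVM p q) {P : Measure (Fin p → ℝ)} {θ : M.Param}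
    (hint : Integrable (fun y => fderiv ℝ (M.psi k y) θ) P) (v : M.Param) :
    Matrix.toEuclideanCLM (𝕜 := ℝ) (M.matB k P θ) v = -(∫ y, fderiv ℝ (M.psi k y) θ ∂P) v := by
  have hbasis : ∀ i j, (∫ y, fderiv ℝ (M.psi k y) θ ∂P) (EuclideanSpace.single j 1) i =
      -M.matB k P θ i j := by
    intro i j
    rw [ContinuousLinearMap.integral_apply hint, GLLVM.matB, Matrix.of_apply, neg_neg]
    exact ((EuclideanSpace.proj (𝕜 := ℝ) i).integral_comp_comm
      (hint.apply_continuousLinearMap (EuclideanSpace.single j (1 : ℝ)))).symm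
  ext i
  have hv : v = ∑ j, v j • EuclideanSpace.single j (1 : ℝ) := by
    simpa using ((EuclideanSpace.basisFun M.free ℝ).sum_repr v).symm
  conv_rhs => rw [hv]
  simp only [Matrix.ofLp_toEuclideanCLM, Matrix.mulVec, dotProduct, map_sum, map_smul,
    PiLp.neg_apply, WithLp.ofLp_sum, Finset.sum_apply, PiLp.smul_apply, hbasis, smul_eq_mul]
  rw [← Finset.sum_neg_distrib]
  exact Finset.sum_congr rfl fun j _ => by ring

theorem proposition2 {p q k : ℕ} (hk : 1 ≤ k) (M : GLLVM p q)
    (hb : ∀ j, ContDiff ℝ 2 (M.b j))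
    -- the sample
    {Ω : Type*} [MeasurableSpace Ω] (μ : Measure Ω) [IsProbabilityMeasure μ]
    (P : Measure (Fin p → ℝ)) (Y : ℕ → Ω → Fin p → ℝ)
    (hY : ∀ l, Measurable (Y l)) (hlaw : ∀ l, μ.map (Y l) = P) (hindep : iIndepFun Y μ)
    -- the parameter space
    (Θ : Set M.Param) (θ₀ : M.Param) (hθ₀ : θ₀ ∈ interior Θ)
    (hΘ : IsCompact Θ ∨ (Convex ℝ Θ ∧ ∀ᵐ y ∂P, ConcaveOn ℝ Θ (M.logAGH k y)))
    (hscale : ∀ θ ∈ Θ, ∀ j, 0 < M.scale θ j)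
    -- the quadrature is well defined
    (hmode : ∀ᵐ y ∂P, ∀ θ ∈ Θ, ∃ z, M.IsRegularMode y θ z)
    -- the approximated log-likelihood is continuous and dominated on compact sets
    (hmeas : ∀ θ ∈ Θ, AEMeasurable (fun y => M.logAGH k y θ) P)
    (hcont : ∀ᵐ y ∂P, ContinuousOn (M.logAGH k y) Θ)
    (hdom : ∀ K ⊆ Θ, IsCompact K → ∃ d : (Fin p → ℝ) → ℝ, Integrable d P ∧
      ∀ᵐ y ∂P, ∀ θ ∈ K, |M.logAGH k y θ| ≤ d y)
    -- `θ₀` is the unique maximizer of its expectation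
    (hmax : ∀ θ ∈ Θ, θ ≠ θ₀ → ∫ y, M.logAGH k y θ ∂P < ∫ y, M.logAGH k y θ₀ ∂P)
    -- its Hessian is continuous and dominated near `θ₀`
    (hsmooth : ∃ U : Set M.Param, IsOpen U ∧ θ₀ ∈ U ∧
      (∀ᵐ y ∂P, ContDiffOn ℝ 2 (M.logAGH k y) U) ∧
      ∃ d : (Fin p → ℝ) → ℝ, Integrable d P ∧
        ∀ᵐ y ∂P, ∀ θ ∈ U, ‖fderiv ℝ (M.psi k y) θ‖ ≤ d y)
    -- `A(θ₀)` is finite and `B(θ₀)` is nonsingular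
    (hA : MemLp (fun y => M.psi k y θ₀) 2 P)
    (hB : IsUnit (M.matB k P θ₀))
    -- the estimators
    (θhat : ℕ → Ω → M.Param) (hest : M.IsAGHEstimator k Θ μ Y θhat) :
    TendstoInDistribution (fun (n : ℕ) ω => √(n : ℝ) • (θhat n ω - θ₀)) atTop id (fun _ => μ)
      (multivariateGaussian 0
        ((M.matB k P θ₀)⁻¹ * M.matA k P θ₀ * ((M.matB k P θ₀)⁻¹)ᵀ)) := by
  obtain ⟨U, hU, hθ₀U, hC2, d, hd, hbound⟩ := hsmooth
  have hθ₀' := interior_subset hθ₀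
  have hsolves : ∀ᶠ x : ℕ × Ω in inProb μ, θhat x.1 x.2 ∈ Θ ∧
      (M.score k x.1 (fun l => Y l x.2) (θhat x.1 x.2) = 0 ∨
        IsMaxOn (M.logLik k x.1 (fun l => Y l x.2)) Θ (θhat x.1 x.2)) :=
    eventually_inProb.2 hest.solves
  have hmem : ∀ᶠ x : ℕ × Ω in inProb μ, θhat x.1 x.2 ∈ Θ := hsolves.mono fun x hx => hx.1
  have hnear : ∀ ε : ℝ, 0 < ε → ∀ᶠ x : ℕ × Ω in inProb μ, ∀ θ ∈ Θ,
      ∑ l ∈ Finset.range x.1, M.logAGH k (Y l x.2) θ ≤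
        ∑ l ∈ Finset.range x.1, M.logAGH k (Y l x.2) (θhat x.1 x.2) + x.1 * ε := by
    intro ε hε
    rw [eventually_inProb]
    simpa only [not_forall, not_le, exists_prop] using! hest.nearlyMaximal ε hε
  have hcons : Tendsto (fun x : ℕ × Ω => θhat x.1 x.2) (inProb μ) (𝓝 θ₀) := by
    rcases hΘ with hΘ | ⟨hΘ, hconc⟩
    · exact tendsto_inProb_of_isCompact hY hlaw hindep hθ₀' hmeas hcont hdom hmax hmem hnear hΘ
    · exact tendsto_inProb_of_concaveOn hY hlaw hindep hθ₀ hmeas hcont hdom hmax hmem hnear hΘ hconc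
  obtain ⟨d₀, hd₀, hdb₀⟩ := hdom {θ₀} (Set.singleton_subset_iff.2 hθ₀') isCompact_singleton
  have hint : Integrable (fun y => M.logAGH k y θ₀) P :=
    hd₀.mono' (hmeas θ₀ hθ₀').aestronglyMeasurable (hdb₀.mono fun y hy => hy θ₀ rfl)
  have hint2 : Integrable (fun y => fderiv ℝ (M.psi k y) θ₀) P :=
    -- Measurability is assumed only on Θ, smoothness only on `U`, hence the intersection.
    integrable_fderiv_gradient (hU.inter isOpen_interior) ⟨hθ₀U, hθ₀⟩
      (fun θ hθ => (hmeas θ (interior_subset hθ.2)).aestronglyMeasurable)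
      (hC2.mono fun y hy => hy.mono Set.inter_subset_left) hd
      (hbound.mono fun y hy θ hθ => hy θ hθ.1)
  have hG : ∀ v, Matrix.toEuclideanCLM (𝕜 := ℝ) (M.matB k P θ₀)⁻¹
      ((∫ y, fderiv ℝ (M.psi k y) θ₀ ∂P) v) = -v := by
    intro v
    rw [← neg_eq_iff_eq_neg.2 (toEuclideanCLM_matB M hint2 v), map_neg,
      ← mul_apply_eq_comp, ← map_mul,
      Matrix.nonsing_inv_mul _ ((Matrix.isUnit_iff_isUnit_det _).1 hB), map_one,
      one_apply_eq_self]
  have hcov := secondMoment_toEuclideanCLM hA (M.matB k P θ₀)⁻¹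
  have hmatA : secondMoment P (fun y => M.psi k y θ₀) = M.matA k P θ₀ := rfl
  rw [hmatA] at hcov
  rw [← hcov]
  exact tendstoInDistribution_of_mEstimator hY hlaw hindep hθ₀ hmeas hint hmax hU hθ₀U hC2 hd hbound
    hA hG hest.aemeasurable hcons (hsolves.mono fun x hx => hx.2)
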